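/- Let $\mathbb D=\{z\in\mathbb C:|z|<1\}$, let $dA=\frac1\pi\,dx\,dy$ be the normalized area measure on $\mathbb D$, and let $L_a^2$ be the Bergman space, i.e. the closed subspace of $L^2(\mathbb D,dA)$ consisting of analytic functions, with orthogonal projection $P:L^2(\mathbb D,dA)\to L_a^2$. Let $k_z=K_z/\|K_z\|_{L^2(\mathbb D,dA)}$, where $K_z(w)=(1-\bar z w)^{-2}$. For $z\in\mathbb D$ and $0<r<1$ put $E(z,r)=\{w\in\mathbb D: |\frac{w-z}{1-\bar w z}|<r\}$. For a finite positive Borel measure $\mu$ on $\mathbb D$, its Berezin transform is $\widetilde\mu(z)=\int_{\mathbb D}|k_z|^2\,d\mu$ ($z\in\mathbb D$); $\mu$ is called a reverse Carleson measure for $L_a^2$ if there is a constant $C>0$ with $\int_{\mathbb D}|f|^2d\mu\ge C\int_{\mathbb D}|f|^2dA$ for all $f\in L_a^2$. **Theorem.** Let $\varphi\in L^\infty(\mathbb D,dA)$ be real-valued with $\varphi\ge 0$ almost everywhere, and let $d\mu=\varphi\,dA$. Then the following are equivalent: (a) the Toeplitz operator $T_\varphi f=P(\varphi f)$ is invertible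 on $L_a^2$; (b) the Berezin transform $\widetilde\varphi=\widetilde\mu$ is invertible in $L^\infty(\mathbb D,dA)$; (b$'$) $\widetilde\varphi$ is bounded below on $\mathbb D$, i.e. there is $\delta>0$ with $|\widetilde\varphi(z)|\ge\delta$ for all $z\in\mathbb D$; (c) there is an $r>0$ such that $\chi_{\{z\in\mathbb D:\varphi(z)>r\}}\,dA$ is a reverse Carleson measure for $L_a^2$; (d) $\mu$ is a reverse Carleson measure for $L_a^2$; (e) $\mu$ satisfies the reverse Carleson condition: there are $r\in(0,1)$ and $C>0$ such that $C^{-1}\le \frac{\mu(E(z,r))}{A(E(z,r))}\le C$ for all $z\in\mathbb D$. -/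

import Mathlib

open MeasureTheory Filter Topology
open scoped ENNReal ComplexConjugate

noncomputable section

namespace Bergman

/-- The open unit disk. -/
def disk : Set ℂ := Metric.ball 0 1

/-- The normalized area measure `dA = (1 / π) dx dy` of the unit disk, as a measure on `ℂ`
carried by the disk. -/
def dA : Measure ℂ := (ENNReal.ofReal Real.pi)⁻¹ • volume.restrict disk

/-- `f` belongs to the Bergman space as a function: it is analytic on the disk and
square integrable there. Its values outside the disk play no role. -/
def IsBergman (f : ℂ → ℂ) : Prop :=
  DifferentiableOn ℂ f disk ∧ MemLp f 2 dA

/-- The Bergman space `L_a^2`, the subspace of `L^2(𝔻, dA)` of (classes of)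
analytic functions on the disk. -/
def bergmanSpace : Submodule ℂ (Lp ℂ 2 dA) where
  carrier := {F | ∃ f, IsBergman f ∧ F =ᵐ[dA] f}
  zero_mem' := ⟨0, ⟨differentiableOn_const 0, MemLp.zero⟩, Lp.coeFn_zero _ _ _⟩
  add_mem' := by
    rintro F G ⟨f, hf, hF⟩ ⟨g, hg, hG⟩
    exact ⟨f + g, ⟨hf.1.add hg.1, hf.2.add hg.2⟩, (Lp.coeFn_add F G).trans (hF.add hG)⟩
  smul_mem' := by
    rintro c F ⟨f, hf, hF⟩
    exact ⟨c • f, ⟨hf.1.const_smul c, hf.2.const_smul c⟩,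
      (Lp.coeFn_smul c F).trans (hF.const_smul c)⟩

theorem isProbabilityMeasure_dA : IsProbabilityMeasure dA := by
  refine ⟨?_⟩
  have h : ENNReal.ofReal Real.pi ≠ 0 := by simp [Real.pi_pos]
  simp only [dA, disk, Measure.smul_apply, Measure.restrict_apply_univ, Complex.volume_ball,
    smul_eq_mul]
  have : (NNReal.pi : ℝ≥0∞) = ENNReal.ofReal Real.pi := by
    rw [← NNReal.coe_real_pi, ENNReal.ofReal_coe_nnreal]
  rw [this]
  simp [ENNReal.inv_mul_cancel h ENNReal.ofReal_ne_top]

instance : IsProbabilityMeasure dA := isProbabilityMeasure_dA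

theorem lintegral_dA (g : ℂ → ℝ≥0∞) :
    ∫⁻ w in disk, g w = ENNReal.ofReal Real.pi * ∫⁻ w, g w ∂dA := by
  have h : ENNReal.ofReal Real.pi ≠ 0 := by simp [Real.pi_pos]
  rw [dA, lintegral_smul_measure, smul_eq_mul, ← mul_assoc,
    ENNReal.mul_inv_cancel h ENNReal.ofReal_ne_top, one_mul]

theorem circle_bound {g : ℂ → ℂ} {ρ : ℝ} (hρ : 0 < ρ)
    (hg : DiffContOnCl ℂ g (Metric.ball 0 ρ)) :
    ENNReal.ofReal (2 * Real.pi) * ‖g 0‖ₑ ≤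
      ∫⁻ θ in Set.Ioo (-Real.pi) Real.pi, ‖g (Complex.polarCoord.symm (ρ, θ))‖ₑ := by
  have h := DiffContOnCl.circleAverage (f := g) (c := 0) (R := ρ) (by rwa [abs_of_pos hρ])
  rw [Real.circleAverage_eq_integral_add (-Real.pi),
    intervalIntegral.integral_comp_add_right (fun θ => g (circleMap 0 ρ θ))] at h
  have e1 : (0 : ℝ) + -Real.pi = -Real.pi := by ring
  have e2 : 2 * Real.pi + -Real.pi = Real.pi := by ring
  have hpi : (0 : ℝ) < 2 * Real.pi := by positivity
  rw [e1, e2, intervalIntegral.integral_of_le (by linarith), integral_Ioc_eq_integral_Ioo,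
    inv_smul_eq_iff₀ hpi.ne'] at h
  have h2 : ∀ θ : ℝ, Complex.polarCoord.symm (ρ, θ) = circleMap 0 ρ θ := by
    intro θ
    rw [Complex.polarCoord_symm_apply, circleMap, Complex.exp_mul_I]
    simp
  simp only [h2]
  calc ENNReal.ofReal (2 * Real.pi) * ‖g 0‖ₑ = ‖(2 * Real.pi) • g 0‖ₑ := by
        rw [enorm_smul, Real.enorm_eq_ofReal hpi.le]
    _ ≤ _ := by
        rw [← h]
        exact enorm_integral_le_lintegral_enorm _

theorem point_bound {f : ℂ → ℂ} (hf : DifferentiableOn ℂ f disk) {z : ℂ} {r : ℝ} (hr : 0 < r)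
    (hz : ‖z‖ + r < 1) :
    ENNReal.ofReal (r ^ 2 / 2) * ‖f z‖ₑ ≤ eLpNorm f 2 dA := by
  classical
  have hsub : ∀ w : ℂ, ‖w‖ ≤ r → z + w ∈ disk := by
    intro w hw
    rw [disk, mem_ball_zero_iff]
    exact (norm_add_le z w).trans_lt (by linarith)
  have hdisk : MeasurableSet disk := Metric.isOpen_ball.measurableSet
  have hmeas : Measurable (disk.piecewise f 0) :=
    hf.continuousOn.measurable_piecewise continuousOn_const hdisk
  have hmeas' : AEStronglyMeasurable f dA := by
    refine hmeas.aestronglyMeasurable.congr ?_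
    filter_upwards [Measure.ae_smul_measure (ae_restrict_mem hdisk) _] with w hw
    exact Set.piecewise_eq_of_mem _ _ _ hw
  set h : ℂ → ℝ≥0∞ := (Metric.ball 0 r).indicator (fun w => ‖disk.piecewise f 0 (z + w)‖ₑ) with hh
  have hmeash : Measurable h :=
    ((hmeas.comp (measurable_const_add z)).enorm).indicator Metric.isOpen_ball.measurableSet
  have hpol : Measurable fun p : ℝ × ℝ => Complex.polarCoord.symm p := by
    simp only [Complex.polarCoord_symm_apply]
    fun_prop
  have hval : ∀ ρ ∈ Set.Ioo (r / 2) r,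
      ENNReal.ofReal (2 * Real.pi) * ‖f z‖ₑ ≤
        ∫⁻ θ in Set.Ioo (-Real.pi) Real.pi, h (Complex.polarCoord.symm (ρ, θ)) := by
    intro ρ hρ
    have hρ0 : 0 < ρ := by linarith [hρ.1]
    have hd : DiffContOnCl ℂ (fun w => f (z + w)) (Metric.ball 0 ρ) := by
      apply DifferentiableOn.diffContOnCl
      rw [closure_ball _ hρ0.ne']
      refine hf.comp (by fun_prop) ?_
      intro w hw
      exact hsub w (by rw [mem_closedBall_zero_iff] at hw; linarith [hρ.2])
    have hc := circle_bound hρ0 hd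
    simp only [add_zero] at hc
    refine hc.trans (le_of_eq ?_)
    refine lintegral_congr fun θ => ?_
    have hn : ‖Complex.polarCoord.symm (ρ, θ)‖ = ρ := by
      rw [Complex.norm_polarCoord_symm, abs_of_pos hρ0]
    rw [hh, Set.indicator_of_mem (by rw [mem_ball_zero_iff, hn]; exact hρ.2),
      Set.piecewise_eq_of_mem _ _ _ (hsub _ (by rw [hn]; exact hρ.2.le))]
  have hlow : ENNReal.ofReal Real.pi * (ENNReal.ofReal (r ^ 2 / 2) * ‖f z‖ₑ) ≤ ∫⁻ w, h w := by
    rw [← Complex.lintegral_comp_polarCoord_symm, polarCoord_target,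
      Measure.volume_eq_prod, ← Measure.prod_restrict, lintegral_prod _
        (by
          simp only [smul_eq_mul]
          exact ((measurable_fst.ennreal_ofReal).mul (hmeash.comp hpol)).aemeasurable)]
    calc ENNReal.ofReal Real.pi * (ENNReal.ofReal (r ^ 2 / 2) * ‖f z‖ₑ)
        = ∫⁻ ρ in Set.Ioo (r / 2) r,
            ENNReal.ofReal (r / 2) * (ENNReal.ofReal (2 * Real.pi) * ‖f z‖ₑ) := by
          rw [setLIntegral_const, Real.volume_Ioo, ← mul_assoc, ← mul_assoc,
            mul_right_comm _ ‖f z‖ₑ,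
            ← ENNReal.ofReal_mul (by positivity), ← ENNReal.ofReal_mul (by positivity),
            ← ENNReal.ofReal_mul (by positivity)]
          congr 2
          ring
      _ ≤ ∫⁻ ρ in Set.Ioo (r / 2) r, ∫⁻ θ in Set.Ioo (-Real.pi) Real.pi,
            ENNReal.ofReal ρ • h (Complex.polarCoord.symm (ρ, θ)) := by
          refine setLIntegral_mono' measurableSet_Ioo fun ρ hρ => ?_
          simp only [smul_eq_mul]
          have hm : Measurable fun θ : ℝ => h (Complex.polarCoord.symm (ρ, θ)) :=
            hmeash.comp (hpol.comp measurable_prodMk_left)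
          rw [lintegral_const_mul _ hm]
          exact mul_le_mul' (ENNReal.ofReal_le_ofReal hρ.1.le) (hval ρ hρ)
      _ ≤ _ := by
          refine lintegral_mono_set ?_
          intro ρ hρ
          exact lt_trans (by positivity) hρ.1
  have hup : ∫⁻ w, h w ≤ ENNReal.ofReal Real.pi * eLpNorm f 1 dA := by
    rw [eLpNorm_one_eq_lintegral_enorm, ← lintegral_dA, ← lintegral_indicator hdisk,
      ← lintegral_add_left_eq_self (disk.indicator fun w => ‖f w‖ₑ) z]
    refine lintegral_mono fun w => ?_
    rw [hh]
    by_cases hw : w ∈ Metric.ball (0 : ℂ) r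
    swap
    · rw [Set.indicator_of_notMem hw]
      exact zero_le
    rw [Set.indicator_of_mem hw]
    have hm := hsub w (mem_ball_zero_iff.1 hw).le
    rw [Set.piecewise_eq_of_mem _ _ _ hm, Set.indicator_of_mem hm]
  have hpi : ENNReal.ofReal Real.pi ≠ 0 := by simp [Real.pi_pos]
  have := (ENNReal.mul_le_mul_iff_right hpi ENNReal.ofReal_ne_top).1 (hlow.trans hup)
  exact this.trans (eLpNorm_le_eLpNorm_of_exponent_le (by norm_num) hmeas')

theorem isClosed_bergmanSpace : IsClosed (bergmanSpace : Set (Lp ℂ 2 dA)) := by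
  rw [← isSeqClosed_iff_isClosed]
  intro F G hF hFG
  choose f hf hFf using hF
  have hG : ∃ g : ℂ → ℂ, DifferentiableOn ℂ g disk ∧ ∀ z ∈ disk,
      Tendsto (fun n => f n z) atTop (𝓝 (g z)) := by
    have hdiff : ∀ m n, eLpNorm (f m - f n) 2 dA = ENNReal.ofReal (dist (F m) (F n)) := by
      intro m n
      rw [← edist_dist, Lp.edist_def]
      exact eLpNorm_congr_ae ((hFf m).sub (hFf n)).symm
    have hC : ∀ R : ℝ, R < 1 → UniformCauchySeqOn f atTop (Metric.closedBall 0 R) := by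
      intro R hR
      rw [Metric.uniformCauchySeqOn_iff]
      intro ε hε
      set r := (1 - R) / 2 with hr
      have hr0 : 0 < r := by rw [hr]; linarith
      obtain ⟨N, hN⟩ := Metric.cauchySeq_iff.1 hFG.cauchySeq (r ^ 2 / 2 * ε) (by positivity)
      refine ⟨N, fun m hm n hn z hz => ?_⟩
      have hb := point_bound ((hf m).1.sub (hf n).1) (z := z) hr0
        (by rw [mem_closedBall_zero_iff] at hz; rw [hr]; linarith)
      rw [hdiff, ← ofReal_norm, ← ENNReal.ofReal_mul (by positivity),
        ENNReal.ofReal_le_ofReal_iff dist_nonneg] at hb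
      have := hb.trans_lt (hN m hm n hn)
      rw [dist_eq_norm]
      exact lt_of_mul_lt_mul_left this (by positivity)
    have hp : ∀ z ∈ disk, ∃ l, Tendsto (fun n => f n z) atTop (𝓝 l) := by
      intro z hz
      apply cauchySeq_tendsto_of_complete
      exact (hC ‖z‖ (mem_ball_zero_iff.1 hz)).cauchySeq (by simp)
    choose! g hg using hp
    refine ⟨g, ?_, hg⟩
    refine TendstoLocallyUniformlyOn.differentiableOn (F := f) (φ := atTop) ?_
      (Eventually.of_forall fun n => (hf n).1) Metric.isOpen_ball
    rw [tendstoLocallyUniformlyOn_iff_forall_isCompact (show IsOpen disk from Metric.isOpen_ball)]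
    intro K hK hKc
    rcases K.eq_empty_or_nonempty with rfl | hne
    · exact tendstoUniformlyOn_empty
    obtain ⟨x, hx, hmax⟩ := hKc.exists_isMaxOn hne continuous_norm.continuousOn
    have hx1 : ‖x‖ < 1 := mem_ball_zero_iff.1 (hK hx)
    refine ((hC ‖x‖ hx1).mono fun y hy => ?_).tendstoUniformlyOn_of_tendsto
      fun y hy => hg y (hK hy)
    rw [mem_closedBall_zero_iff]
    exact hmax hy
  obtain ⟨g, hg, hlim⟩ := hG
  have hae : G =ᵐ[dA] g := by
    have h1 := tendstoInMeasure_of_tendsto_Lp hFG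
    obtain ⟨ns, hns, h2⟩ := h1.exists_seq_tendsto_ae
    have h3 : ∀ᵐ z ∂dA, z ∈ disk :=
      Measure.ae_smul_measure (ae_restrict_mem Metric.isOpen_ball.measurableSet) _
    filter_upwards [h2, h3, ae_all_iff.2 hFf] with z h2 h3 h4
    simp only [h4] at h2
    exact tendsto_nhds_unique h2 ((hlim z h3).comp hns.tendsto_atTop)
  exact ⟨g, ⟨hg, (memLp_congr_ae hae).1 (Lp.memLp G)⟩, hae⟩

instance : CompleteSpace bergmanSpace := isClosed_bergmanSpace.completeSpace_coe

/-- The Toeplitz operator `T_φ f = P (φ f)` on the Bergman space, `φ ∈ L^∞(𝔻, dA)`, where `P` is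
the orthogonal projection of `L^2(𝔻, dA)` onto the Bergman space. -/
def toeplitz (φ : ℂ → ℂ) (hφ : MemLp φ ∞ dA) : bergmanSpace →L[ℂ] bergmanSpace :=
  bergmanSpace.orthogonalProjectionOnto ∘L
    ((ContinuousLinearMap.mul ℂ ℂ).holderL dA ∞ 2 2 (hφ.toLp φ)) ∘L bergmanSpace.subtypeL

/-- The reproducing kernel `K_z(w) = 1 / (1 - conj z * w)^2`. -/
def kernel (z w : ℂ) : ℂ := 1 / (1 - conj z * w) ^ 2

/-- The normalized reproducing kernel `k_z = K_z / ‖K_z‖`, with the norm of `L^2(𝔻, dA)`. -/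
def normalizedKernel (z w : ℂ) : ℂ :=
  kernel z w / (Real.sqrt (∫ v, ‖kernel z v‖ ^ 2 ∂dA) : ℝ)

/-- The Berezin transform of a measure on the disk. -/
def berezin (μ : Measure ℂ) (z : ℂ) : ℝ :=
  ∫ w in disk, ‖normalizedKernel z w‖ ^ 2 ∂μ

/-- The function `u` is an invertible element of the algebra `L^∞(𝔻, dA)`. -/
def IsInvertibleLinfty (u : ℂ → ℝ) : Prop :=
  MemLp u ∞ dA ∧ ∃ v : ℂ → ℝ, MemLp v ∞ dA ∧ ∀ᵐ z ∂dA, u z * v z = 1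

/-- The function `u` is bounded below (in modulus, by a positive constant) on the disk. -/
def IsBoundedBelowOnDisk (u : ℂ → ℝ) : Prop :=
  ∃ δ : ℝ, 0 < δ ∧ ∀ z ∈ disk, δ ≤ |u z|

/-- The measure `μ` is a reverse Carleson measure for the Bergman space. -/
def IsReverseCarleson (μ : Measure ℂ) : Prop :=
  ∃ C : ℝ, 0 < C ∧ ∀ f : ℂ → ℂ, IsBergman f →
    ENNReal.ofReal C * ∫⁻ z in disk, ‖f z‖ₑ ^ 2 ∂dA ≤ ∫⁻ z in disk, ‖f z‖ₑ ^ 2 ∂μ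

/-- The pseudo-hyperbolic distance. -/
def rho (z w : ℂ) : ℝ := ‖(w - z) / (1 - conj w * z)‖

/-- The pseudo-hyperbolic disk with center `z` and radius `r`. -/
def pseudoDisk (z : ℂ) (r : ℝ) : Set ℂ := {w ∈ disk | rho z w < r}

/-- The reverse Carleson condition: for some `r`, the averages of `μ` over the pseudo-hyperbolic
disks of radius `r` are bounded above and below. -/
def ReverseCarlesonCondition (μ : Measure ℂ) : Prop :=
  ∃ r : ℝ, 0 < r ∧ r < 1 ∧ ∃ C : ℝ, 0 < C ∧ ∀ z ∈ disk,
    C⁻¹ ≤ μ.real (pseudoDisk z r) / dA.real (pseudoDisk z r) ∧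
      μ.real (pseudoDisk z r) / dA.real (pseudoDisk z r) ≤ C

/-- The measure `φ dA`, for a nonnegative function `φ`. -/
def measureOf (φ : ℂ → ℝ) : Measure ℂ := dA.withDensity fun z => ENNReal.ofReal (φ z)

/-- The measure `χ_G dA`. -/
def charMeasure (G : Set ℂ) : Measure ℂ := dA.restrict G

end Bergman

end

/-! Everything rests on one change of variables. The automorphism `mobius z` exchanges `0` and `z`,
and its real Jacobian `jac z` is exactly `|k_z|²`. Hence the Berezin transform at `z` is the mean of
`φ ∘ mobius z` over the disk, and pseudo-hyperbolic disks about `z` pull back to Euclidean balls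
about `0`.

(a) ⇔ (d): `⟨T_φ f, f⟩ = ∫ φ|f|²`. If this form is coercive, Lax–Milgram inverts `T_φ`; conversely
`φ² ≤ Mφ` turns a lower bound for `‖T_φ f‖` into one for the form (`isUnit_toeplitz_iff`). (b) ⇔
(b'): the Berezin transform is bounded and continuous. (d) ⇒ (b'): test on `k_z`. (b') ⇒ (e): since
`φ` is bounded, a ball of radius close to `1` carries half of the mean of `φ ∘ mobius z`. (e) ⇒ (c):
by Chebyshev, some superlevel set `G` of `φ` fills a fixed proportion of every pseudo-hyperbolic
disk, and Luecking's theorem applies. (c) ⇒ (d): `φ > r` on `G`.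

Luecking's theorem is the hard step. Call `z` good if `|f(z)|²` is at least a fixed small multiple
of the weighted mean of `|f ∘ mobius z|²`. At a good point `f ∘ mobius z` is bounded on a ball by a
multiple of its value at `0`; Jensen's inequality then says that it is small only on a set of small
area, so the part of `G` in the ball sees a fixed share of `|f(z)|²`. The weighted mean is bounded
on `L¹` (`lintegral_weightedMean_le`), so the bad points contribute at most half of the total and
are absorbed. -/

noncomputable section

namespace Bergman

/-! ### Automorphisms of the disk and change of variables -/

/-- The involutive automorphism of the disk that exchanges `0` and `z`. -/
def mobius (z u : ℂ) : ℂ := (z - u) / (1 - conj z * u)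

/-- The real Jacobian of `mobius z`, equal to the squared modulus of the normalized kernel. -/
def jac (z u : ℂ) : ℝ := (1 - ‖z‖ ^ 2) ^ 2 / ‖1 - conj z * u‖ ^ 4

theorem mem_disk {z : ℂ} : z ∈ disk ↔ ‖z‖ < 1 := mem_ball_zero_iff

theorem isOpen_disk : IsOpen disk := Metric.isOpen_ball

theorem measurableSet_disk : MeasurableSet disk := isOpen_disk.measurableSet

theorem ae_mem_disk : ∀ᵐ z ∂dA, z ∈ disk :=
  Measure.ae_smul_measure (ae_restrict_mem measurableSet_disk) _

theorem one_sub_norm_sq_pos {z : ℂ} (hz : z ∈ disk) : 0 < 1 - ‖z‖ ^ 2 := by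
  have := mem_disk.1 hz
  nlinarith [norm_nonneg z]

theorem norm_conj_mul (z u : ℂ) : ‖conj z * u‖ = ‖z‖ * ‖u‖ := by
  rw [norm_mul, RCLike.norm_conj]

theorem one_sub_norm_le {z u : ℂ} (hz : z ∈ disk) : 1 - ‖u‖ ≤ ‖1 - conj z * u‖ := by
  have h := norm_sub_norm_le (1 : ℂ) (conj z * u)
  rw [norm_one, norm_conj_mul] at h
  nlinarith [norm_nonneg u, mem_disk.1 hz]

theorem norm_one_sub_conj_mul_comm (z u : ℂ) : ‖1 - conj z * u‖ = ‖1 - conj u * z‖ := by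
  rw [← RCLike.norm_conj]
  simp [mul_comm]

theorem one_sub_norm_le' {z u : ℂ} (hu : u ∈ disk) : 1 - ‖z‖ ≤ ‖1 - conj z * u‖ := by
  rw [norm_one_sub_conj_mul_comm]
  exact one_sub_norm_le hu

theorem norm_one_sub_pos {z u : ℂ} (hz : z ∈ disk) (hu : u ∈ disk) :
    0 < ‖1 - conj z * u‖ := by
  have := one_sub_norm_le (u := u) hz
  linarith [mem_disk.1 hu]

theorem one_sub_ne_zero {z u : ℂ} (hz : z ∈ disk) (hu : u ∈ disk) : 1 - conj z * u ≠ 0 :=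
  norm_pos_iff.1 (norm_one_sub_pos hz hu)

theorem norm_one_sub_le_two {z u : ℂ} (hz : z ∈ disk) (hu : u ∈ disk) :
    ‖1 - conj z * u‖ ≤ 2 := by
  have h := norm_sub_le (1 : ℂ) (conj z * u)
  rw [norm_one, norm_conj_mul] at h
  nlinarith [norm_nonneg u, norm_nonneg z, mem_disk.1 hz, mem_disk.1 hu]

/-- The algebraic source of the Möbius estimates: dividing by the left side computes `1 - ‖mobius z
u‖ ^ 2`, hence the invariance of the disk. -/
theorem norm_one_sub_sq (z u : ℂ) :
    ‖1 - conj z * u‖ ^ 2 = ‖z - u‖ ^ 2 + (1 - ‖z‖ ^ 2) * (1 - ‖u‖ ^ 2) := by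
  simp only [← Complex.normSq_eq_norm_sq, Complex.normSq_apply, Complex.sub_re, Complex.sub_im,
    Complex.mul_re, Complex.mul_im, Complex.conj_re, Complex.conj_im, Complex.one_re,
    Complex.one_im]
  ring

theorem one_sub_norm_mobius_sq {z u : ℂ} (hz : z ∈ disk) (hu : u ∈ disk) :
    1 - ‖mobius z u‖ ^ 2 = (1 - ‖z‖ ^ 2) * (1 - ‖u‖ ^ 2) / ‖1 - conj z * u‖ ^ 2 := by
  have h := norm_one_sub_pos hz hu
  rw [mobius, norm_div, div_pow, eq_div_iff (by positivity), sub_mul,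
    div_mul_cancel₀ _ (by positivity), norm_one_sub_sq]
  ring

theorem mobius_mem_disk {z u : ℂ} (hz : z ∈ disk) (hu : u ∈ disk) : mobius z u ∈ disk := by
  have h : 0 < 1 - ‖mobius z u‖ ^ 2 := by
    rw [one_sub_norm_mobius_sq hz hu]
    have := norm_one_sub_pos hz hu
    have := one_sub_norm_sq_pos hz
    have := one_sub_norm_sq_pos hu
    positivity
  rw [mem_disk]
  nlinarith [norm_nonneg (mobius z u)]

theorem conj_mul_self_ne_one {z : ℂ} (hz : z ∈ disk) : 1 - conj z * z ≠ 0 :=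
  one_sub_ne_zero hz hz

theorem one_sub_conj_mul_mobius {z u : ℂ} (hz : z ∈ disk) (hu : u ∈ disk) :
    1 - conj z * mobius z u = (1 - conj z * z) / (1 - conj z * u) := by
  have := one_sub_ne_zero hz hu
  rw [mobius]
  field_simp
  ring

theorem mobius_mobius {z u : ℂ} (hz : z ∈ disk) (hu : u ∈ disk) : mobius z (mobius z u) = u := by
  have h1 := one_sub_ne_zero hz hu
  have h2 := conj_mul_self_ne_one hz
  rw [mobius, one_sub_conj_mul_mobius hz hu, mobius, div_div_eq_mul_div, div_eq_iff h2, sub_mul,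
    div_mul_cancel₀ _ h1]
  ring

@[simp] theorem mobius_zero (z : ℂ) : mobius z 0 = z := by simp [mobius]

theorem hasDerivAt_mobius {z u : ℂ} (hz : z ∈ disk) (hu : u ∈ disk) :
    HasDerivAt (mobius z) (-(1 - conj z * z) / (1 - conj z * u) ^ 2) u := by
  have h1 : HasDerivAt (fun u => z - u) (-1) u := (hasDerivAt_id u).const_sub z
  have h2 : HasDerivAt (fun u => 1 - conj z * u) (-(conj z * 1)) u :=
    ((hasDerivAt_id u).const_mul (conj z)).const_sub 1
  refine (h1.div h2 (one_sub_ne_zero hz hu)).congr_deriv ?_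
  congr 1
  ring

theorem norm_one_sub_conj_mul_self {z : ℂ} (hz : z ∈ disk) :
    ‖1 - conj z * z‖ = 1 - ‖z‖ ^ 2 := by
  have h := norm_one_sub_sq z z
  rw [sub_self, norm_zero] at h
  have := one_sub_norm_sq_pos hz
  nlinarith [norm_nonneg (1 - conj z * z)]

theorem jac_nonneg (z u : ℂ) : 0 ≤ jac z u := by
  rw [jac]
  positivity

theorem norm_deriv_mobius_sq {z u : ℂ} (hz : z ∈ disk) :
    ‖-(1 - conj z * z) / (1 - conj z * u) ^ 2‖ ^ 2 = jac z u := by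
  rw [norm_div, norm_neg, norm_one_sub_conj_mul_self hz, norm_pow, div_pow, jac]
  ring

/-- The real determinant of multiplication by `c` is the field norm of `c` from `ℂ` to `ℝ`. -/
theorem abs_det_restrictScalars (c : ℂ) :
    |((ContinuousLinearMap.toSpanSingleton ℂ c).restrictScalars ℝ).det| = ‖c‖ ^ 2 := by
  have h : ((ContinuousLinearMap.toSpanSingleton ℂ c).restrictScalars ℝ).det = ‖c‖ ^ 2 := by
    simp [ContinuousLinearMap.det, LinearMap.det_restrictScalars, Algebra.norm_complex_apply,
      Complex.normSq_eq_norm_sq]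
  rw [h, abs_of_nonneg (by positivity)]

theorem setLIntegral_image_of_hasDerivAt {p p' : ℂ → ℂ} {s : Set ℂ} (hs : MeasurableSet s)
    (hp : ∀ u ∈ s, HasDerivAt p (p' u) u) (hinj : Set.InjOn p s) (h : ℂ → ℝ≥0∞) :
    ∫⁻ w in p '' s, h w = ∫⁻ u in s, ENNReal.ofReal (‖p' u‖ ^ 2) * h (p u) := by
  rw [lintegral_image_eq_lintegral_abs_det_fderiv_mul volume hs
    (f' := fun u => (ContinuousLinearMap.toSpanSingleton ℂ (p' u)).restrictScalars ℝ)
    (fun u hu => ((hp u hu).hasFDerivAt.restrictScalars ℝ).hasFDerivWithinAt) hinj h]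
  simp only [abs_det_restrictScalars]

theorem pi_cancel {a b : ℝ≥0∞} (h : ENNReal.ofReal Real.pi * a = ENNReal.ofReal Real.pi * b) :
    a = b :=
  (ENNReal.mul_right_inj (by simp [Real.pi_pos]) ENNReal.ofReal_ne_top).1 h

theorem mobius_image_disk {z : ℂ} (hz : z ∈ disk) : mobius z '' disk = disk := by
  ext w
  constructor
  · rintro ⟨u, hu, rfl⟩
    exact mobius_mem_disk hz hu
  · intro hw
    exact ⟨mobius z w, mobius_mem_disk hz hw, mobius_mobius hz hw⟩

theorem mobius_injOn {z : ℂ} (hz : z ∈ disk) : Set.InjOn (mobius z) disk := by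
  intro u hu v hv huv
  rw [← mobius_mobius hz hu, huv, mobius_mobius hz hv]

theorem lintegral_eq_lintegral_mobius {z : ℂ} (hz : z ∈ disk) (h : ℂ → ℝ≥0∞) :
    ∫⁻ w, h w ∂dA = ∫⁻ u, ENNReal.ofReal (jac z u) * h (mobius z u) ∂dA := by
  apply pi_cancel
  rw [← lintegral_dA, ← lintegral_dA]
  conv_lhs => rw [← mobius_image_disk hz]
  rw [setLIntegral_image_of_hasDerivAt measurableSet_disk (fun u hu => hasDerivAt_mobius hz hu)
    (mobius_injOn hz)]
  simp only [norm_deriv_mobius_sq hz]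

/-- Since `mobius z` is its own inverse, the same Jacobian serves in both directions. -/
theorem lintegral_comp_mobius {z : ℂ} (hz : z ∈ disk) (h : ℂ → ℝ≥0∞) :
    ∫⁻ u, h (mobius z u) ∂dA = ∫⁻ w, ENNReal.ofReal (jac z w) * h w ∂dA := by
  rw [lintegral_eq_lintegral_mobius hz]
  refine lintegral_congr_ae ?_
  filter_upwards [ae_mem_disk] with u hu
  rw [mobius_mobius hz hu]

theorem lintegral_jac {z : ℂ} (hz : z ∈ disk) : ∫⁻ w, ENNReal.ofReal (jac z w) ∂dA = 1 := by
  simpa using (lintegral_comp_mobius hz fun _ => 1).symm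

/-! ### Reproducing kernels -/

theorem norm_kernel_sq (z w : ℂ) : ‖kernel z w‖ ^ 2 = 1 / ‖1 - conj z * w‖ ^ 4 := by
  rw [kernel, norm_div, norm_one, norm_pow, div_pow]
  ring

theorem norm_kernel_sq_eq {z : ℂ} (hz : z ∈ disk) (w : ℂ) :
    ‖kernel z w‖ ^ 2 = ((1 - ‖z‖ ^ 2) ^ 2)⁻¹ * jac z w := by
  have := one_sub_norm_sq_pos hz
  rw [norm_kernel_sq, jac]
  field_simp

theorem measurable_jac_right (z : ℂ) : Measurable (jac z) := by
  unfold jac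
  fun_prop

theorem integral_jac {z : ℂ} (hz : z ∈ disk) : ∫ w, jac z w ∂dA = 1 := by
  rw [integral_eq_lintegral_of_nonneg_ae (ae_of_all _ (jac_nonneg z))
    (measurable_jac_right z).aestronglyMeasurable, lintegral_jac hz, ENNReal.toReal_one]

/-- The total mass of `jac z` is one, which gives `‖K_z‖ = (1 - |z|²)⁻¹` with no power series.
Integrating against `|k_z|²` is therefore averaging after composition with `mobius z`. -/
theorem norm_normalizedKernel_sq {z : ℂ} (hz : z ∈ disk) (w : ℂ) :
    ‖normalizedKernel z w‖ ^ 2 = jac z w := by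
  have h := one_sub_norm_sq_pos hz
  have h1 : ∫ v, ‖kernel z v‖ ^ 2 ∂dA = ((1 - ‖z‖ ^ 2) ^ 2)⁻¹ := by
    simp only [norm_kernel_sq_eq hz]
    rw [integral_const_mul, integral_jac hz, mul_one]
  rw [normalizedKernel, h1, norm_div, div_pow, norm_kernel_sq_eq hz, Complex.norm_real,
    Real.norm_eq_abs, sq_abs, Real.sq_sqrt (by positivity)]
  field_simp

/-! ### Measures carried by the disk -/

theorem restrict_disk_dA : dA.restrict disk = dA :=
  Measure.restrict_eq_self_of_ae_mem ae_mem_disk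

theorem restrict_disk_of_absolutelyContinuous {μ : Measure ℂ} (hμ : μ ≪ dA) :
    μ.restrict disk = μ :=
  Measure.restrict_eq_self_of_ae_mem (hμ.ae_le ae_mem_disk)

theorem measureOf_absolutelyContinuous (φ : ℂ → ℝ) : measureOf φ ≪ dA :=
  withDensity_absolutelyContinuous _ _

theorem restrict_disk_measureOf (φ : ℂ → ℝ) : (measureOf φ).restrict disk = measureOf φ :=
  restrict_disk_of_absolutelyContinuous (measureOf_absolutelyContinuous φ)

theorem restrict_disk_charMeasure (G : Set ℂ) : (charMeasure G).restrict disk = charMeasure G :=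
  restrict_disk_of_absolutelyContinuous Measure.restrict_le_self.absolutelyContinuous

theorem lintegral_measureOf {φ : ℂ → ℝ} (hφ : AEMeasurable φ dA) (f : ℂ → ℝ≥0∞) :
    ∫⁻ z, f z ∂measureOf φ = ∫⁻ z, ENNReal.ofReal (φ z) * f z ∂dA :=
  lintegral_withDensity_eq_lintegral_mul_non_measurable₀ _ hφ.ennreal_ofReal
    (ae_of_all _ fun _ => ENNReal.ofReal_lt_top) f

theorem isReverseCarleson_measureOf {φ : ℂ → ℝ} (hφ : AEMeasurable φ dA) :
    IsReverseCarleson (measureOf φ) ↔ ∃ C : ℝ, 0 < C ∧ ∀ f : ℂ → ℂ, IsBergman f →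
      ENNReal.ofReal C * ∫⁻ z, ‖f z‖ₑ ^ 2 ∂dA ≤
        ∫⁻ z, ENNReal.ofReal (φ z) * ‖f z‖ₑ ^ 2 ∂dA := by
  simp only [IsReverseCarleson, restrict_disk_measureOf, restrict_disk_dA,
    lintegral_measureOf hφ]

theorem isReverseCarleson_charMeasure {G : Set ℂ} :
    IsReverseCarleson (charMeasure G) ↔ ∃ C : ℝ, 0 < C ∧ ∀ f : ℂ → ℂ, IsBergman f →
      ENNReal.ofReal C * ∫⁻ z, ‖f z‖ₑ ^ 2 ∂dA ≤ ∫⁻ z in G, ‖f z‖ₑ ^ 2 ∂dA := by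
  simp only [IsReverseCarleson, restrict_disk_charMeasure, restrict_disk_dA]
  rfl

/-! ### Boundedness and continuity of the Berezin transform -/

theorem integrable_jac {z : ℂ} (hz : z ∈ disk) : Integrable (jac z) dA :=
  ⟨(measurable_jac_right z).aestronglyMeasurable, by
    rw [hasFiniteIntegral_iff_ofReal (ae_of_all _ (jac_nonneg z)), lintegral_jac hz]
    exact ENNReal.one_lt_top⟩

/-- The bound `M` guarantees integrability; otherwise the Bochner integral in `berezin` would
default to `0`. -/
theorem ofReal_berezin {φ : ℂ → ℝ} (hφ : Measurable φ) {M : ℝ} (hM : ∀ z, φ z ≤ M) {z : ℂ}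
    (hz : z ∈ disk) :
    ENNReal.ofReal (berezin (measureOf φ) z) =
      ∫⁻ w, ENNReal.ofReal (φ w) * ENNReal.ofReal (jac z w) ∂dA := by
  rw [berezin, restrict_disk_measureOf]
  simp only [norm_normalizedKernel_sq hz]
  rw [ofReal_integral_eq_lintegral_ofReal _ (ae_of_all _ (jac_nonneg z)),
    lintegral_measureOf hφ.aemeasurable]
  refine ⟨(measurable_jac_right z).aestronglyMeasurable, ?_⟩
  rw [hasFiniteIntegral_iff_ofReal (ae_of_all _ (jac_nonneg z)),
    lintegral_measureOf hφ.aemeasurable]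
  calc ∫⁻ w, ENNReal.ofReal (φ w) * ENNReal.ofReal (jac z w) ∂dA
      ≤ ∫⁻ w, ENNReal.ofReal M * ENNReal.ofReal (jac z w) ∂dA := by
        gcongr with w
        exact hM w
    _ < ∞ := by
        rw [lintegral_const_mul _ (measurable_jac_right z).ennreal_ofReal, lintegral_jac hz]
        simp

theorem berezin_nonneg (μ : Measure ℂ) (z : ℂ) : 0 ≤ berezin μ z :=
  integral_nonneg fun _ => by positivity

theorem berezin_eq {φ : ℂ → ℝ} (hφ : Measurable φ) (h0 : ∀ z, 0 ≤ φ z) {M : ℝ}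
    (hM : ∀ z, φ z ≤ M) {z : ℂ} (hz : z ∈ disk) :
    berezin (measureOf φ) z = ∫ w, φ w * jac z w ∂dA := by
  rw [← ENNReal.toReal_ofReal (berezin_nonneg _ z), ofReal_berezin hφ hM hz,
    integral_eq_lintegral_of_nonneg_ae (ae_of_all _ fun w => mul_nonneg (h0 w) (jac_nonneg z w))
      (hφ.mul (measurable_jac_right z)).aestronglyMeasurable]
  simp only [ENNReal.ofReal_mul (h0 _)]

theorem berezin_le {φ : ℂ → ℝ} (hφ : Measurable φ) (h0 : ∀ z, 0 ≤ φ z) {M : ℝ}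
    (hM : ∀ z, φ z ≤ M) {z : ℂ} (hz : z ∈ disk) : berezin (measureOf φ) z ≤ M := by
  rw [berezin_eq hφ h0 hM hz]
  calc ∫ w, φ w * jac z w ∂dA ≤ ∫ w, M * jac z w ∂dA := by
        refine integral_mono_of_nonneg (ae_of_all _ fun w => mul_nonneg (h0 w) (jac_nonneg z w))
          ((integrable_jac hz).const_mul M) (ae_of_all _ fun w => ?_)
        exact mul_le_mul_of_nonneg_right (hM w) (jac_nonneg z w)
    _ = M := by rw [integral_const_mul, integral_jac hz, mul_one]

theorem jac_le {z u : ℂ} (hz : z ∈ disk) (hu : u ∈ disk) : jac z u ≤ 1 / (1 - ‖z‖) ^ 4 := by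
  have h1 : 0 < 1 - ‖z‖ := by linarith [mem_disk.1 hz]
  have h2 : (1 - ‖z‖ ^ 2) ^ 2 ≤ 1 := by
    have := one_sub_norm_sq_pos hz
    nlinarith [sq_nonneg ‖z‖]
  rw [jac]
  gcongr
  exact one_sub_norm_le' hu

theorem continuousAt_jac {z u : ℂ} (hz : z ∈ disk) (hu : u ∈ disk) :
    ContinuousAt (fun z => jac z u) z := by
  have h : ‖1 - conj z * u‖ ^ 4 ≠ 0 := (pow_pos (norm_one_sub_pos hz hu) 4).ne'
  unfold jac
  refine ContinuousAt.div ?_ ?_ h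
  · fun_prop
  · exact (Continuous.pow (by fun_prop) _).continuousAt

theorem continuousOn_berezin {φ : ℂ → ℝ} (hφ : Measurable φ) (h0 : ∀ z, 0 ≤ φ z) {M : ℝ}
    (hM : ∀ z, φ z ≤ M) : ContinuousOn (berezin (measureOf φ)) disk := by
  refine ContinuousOn.congr (f := fun z => ∫ w, φ w * jac z w ∂dA) ?_
    fun z hz => berezin_eq hφ h0 hM hz
  intro z hz
  refine ContinuousAt.continuousWithinAt ?_
  have hz1 := mem_disk.1 hz
  -- A radius strictly between `‖z‖` and `1`: for `‖x‖ < s` the Jacobians have a common bound, which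
  -- is the dominating constant.
  set s := (1 + ‖z‖) / 2 with hs
  have hev : ∀ᶠ x in 𝓝 z, ‖x‖ < s :=
    continuous_norm.continuousAt.eventually_lt continuousAt_const (by rw [hs]; linarith)
  refine continuousAt_of_dominated (bound := fun _ => M * (1 / (1 - s) ^ 4)) ?_ ?_
    (integrable_const _) ?_
  · exact Eventually.of_forall fun x => (hφ.mul (measurable_jac_right x)).aestronglyMeasurable
  · filter_upwards [hev] with x hx
    filter_upwards [ae_mem_disk] with w hw
    have hxd : x ∈ disk := mem_disk.2 (by linarith)
    rw [Real.norm_of_nonneg (mul_nonneg (h0 w) (jac_nonneg x w))]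
    have h1 : 0 < 1 - s := by linarith
    refine mul_le_mul (hM w) ((jac_le hxd hw).trans ?_) (jac_nonneg x w) ((h0 w).trans (hM w))
    gcongr
  · filter_upwards [ae_mem_disk] with w hw
    exact continuousAt_const.mul (continuousAt_jac hz hw)

/-! ### Invertibility in `L^∞` and lower bounds -/

theorem volume_restrict_absolutelyContinuous_dA : volume.restrict disk ≪ dA :=
  Measure.absolutelyContinuous_smul (by simp)

theorem exists_ae_norm_le {E : Type*} [NormedAddCommGroup E] {f : ℂ → E} (hf : MemLp f ∞ dA) :
    ∃ K : ℝ, ∀ᵐ z ∂dA, ‖f z‖ ≤ K := by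
  have h2 : eLpNormEssSup f dA ≠ ∞ := by
    rw [← eLpNorm_exponent_top]
    exact hf.2.ne
  refine ⟨(eLpNormEssSup f dA).toReal, ?_⟩
  filter_upwards [ae_le_eLpNormEssSup (f := f) (μ := dA)] with z hz
  rw [← toReal_enorm]
  exact ENNReal.toReal_mono h2 hz

/-- Continuity upgrades the almost everywhere bound to every point: the set where `|u|` is too small
is open, so if it were nonempty it would have positive area. -/
theorem isInvertibleLinfty_iff_isBoundedBelowOnDisk {u : ℂ → ℝ} (hu : ContinuousOn u disk) {M : ℝ}
    (hM : ∀ z ∈ disk, |u z| ≤ M) : IsInvertibleLinfty u ↔ IsBoundedBelowOnDisk u := by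
  constructor
  · rintro ⟨-, v, hv, huv⟩
    obtain ⟨K, hK⟩ := exists_ae_norm_le hv
    refine ⟨1 / (|K| + 1), by positivity, ?_⟩
    by_contra! h
    obtain ⟨z, hz, hlt⟩ := h
    have hopen : IsOpen (disk ∩ u ⁻¹' {x | |x| < 1 / (|K| + 1)}) :=
      hu.isOpen_inter_preimage isOpen_disk (isOpen_lt continuous_abs continuous_const)
    have hpos := hopen.measure_pos volume ⟨z, hz, hlt⟩
    have hnull : ∀ᵐ w ∂dA, w ∉ disk ∩ u ⁻¹' {x | |x| < 1 / (|K| + 1)} := by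
      filter_upwards [hK, huv] with w h1 h2 h3
      have h4 : |u w| * |v w| = 1 := by rw [← abs_mul, h2, abs_one]
      have h5 : |u w| < 1 / (|K| + 1) := h3.2
      rw [lt_div_iff₀ (by positivity)] at h5
      rw [Real.norm_eq_abs] at h1
      nlinarith [abs_nonneg (u w), le_abs_self K]
    have h6 : ∀ᵐ w ∂volume.restrict disk, w ∉ disk ∩ u ⁻¹' {x | |x| < 1 / (|K| + 1)} :=
      volume_restrict_absolutelyContinuous_dA.ae_le hnull
    rw [ae_restrict_iff' measurableSet_disk] at h6
    refine hpos.ne' (measure_mono_null ?_ h6)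
    intro w hw h7
    exact h7 hw.1 hw
  · rintro ⟨δ, hδ, h⟩
    have hmeas : ∀ f : ℂ → ℝ, ContinuousOn f disk → AEStronglyMeasurable f dA := fun f hf => by
      rw [← restrict_disk_dA]
      exact hf.aestronglyMeasurable measurableSet_disk
    have h0 : ∀ z ∈ disk, u z ≠ 0 := fun z hz h1 => by
      have := h z hz
      rw [h1, abs_zero] at this
      linarith
    refine ⟨memLp_top_of_bound (hmeas u hu) M ?_, fun z => (u z)⁻¹,
      memLp_top_of_bound (hmeas _ (hu.inv₀ h0)) δ⁻¹ ?_, ?_⟩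
    · filter_upwards [ae_mem_disk] with z hz using hM z hz
    · filter_upwards [ae_mem_disk] with z hz
      rw [norm_inv]
      exact inv_anti₀ hδ (h z hz)
    · filter_upwards [ae_mem_disk] with z hz using mul_inv_cancel₀ (h0 z hz)

/-! ### Consequences and sources of the reverse Carleson inequality -/

theorem ofReal_jac {z : ℂ} (hz : z ∈ disk) (w : ℂ) :
    ENNReal.ofReal (jac z w) = ‖normalizedKernel z w‖ₑ ^ 2 := by
  rw [← norm_normalizedKernel_sq hz, ENNReal.ofReal_pow (norm_nonneg _), ofReal_norm]

theorem isBergman_normalizedKernel {z : ℂ} (hz : z ∈ disk) : IsBergman (normalizedKernel z) := by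
  have hd : DifferentiableOn ℂ (normalizedKernel z) disk := by
    unfold normalizedKernel kernel
    refine DifferentiableOn.div_const (DifferentiableOn.div (by fun_prop) (by fun_prop) ?_) _
    intro w hw
    exact pow_ne_zero _ (one_sub_ne_zero hz hw)
  have hm : AEStronglyMeasurable (normalizedKernel z) dA := by
    rw [← restrict_disk_dA]
    exact hd.continuousOn.aestronglyMeasurable measurableSet_disk
  refine ⟨hd, (memLp_two_iff_integrable_sq_norm hm).2 ?_⟩
  simp only [norm_normalizedKernel_sq hz]
  exact integrable_jac hz

/-- Test the inequality on `k_z`: its norm is one, and its integral against the measure is the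
Berezin transform at `z`. -/
theorem IsReverseCarleson.isBoundedBelowOnDisk {φ : ℂ → ℝ} (hφ : Measurable φ)
    {M : ℝ} (hM : ∀ z, φ z ≤ M) (h : IsReverseCarleson (measureOf φ)) :
    IsBoundedBelowOnDisk (berezin (measureOf φ)) := by
  obtain ⟨C, hC, h⟩ := (isReverseCarleson_measureOf hφ.aemeasurable).1 h
  refine ⟨C, hC, fun z hz => ?_⟩
  have h1 := h _ (isBergman_normalizedKernel hz)
  simp only [← ofReal_jac hz] at h1
  rw [lintegral_jac hz, mul_one, ← ofReal_berezin hφ hM hz,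
    ENNReal.ofReal_le_ofReal_iff (berezin_nonneg _ _)] at h1
  exact h1.trans (le_abs_self _)

theorem IsReverseCarleson.of_charMeasure {φ : ℂ → ℝ} (hφ : Measurable φ) {r : ℝ} (hr : 0 < r)
    (h : IsReverseCarleson (charMeasure {z | z ∈ disk ∧ r < φ z})) :
    IsReverseCarleson (measureOf φ) := by
  obtain ⟨C, hC, h⟩ := isReverseCarleson_charMeasure.1 h
  have hG : MeasurableSet {z | z ∈ disk ∧ r < φ z} :=
    measurableSet_disk.inter (measurableSet_lt measurable_const hφ)
  refine (isReverseCarleson_measureOf hφ.aemeasurable).2 ⟨r * C, by positivity, fun f hf => ?_⟩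
  calc ENNReal.ofReal (r * C) * ∫⁻ z, ‖f z‖ₑ ^ 2 ∂dA
      = ENNReal.ofReal r * (ENNReal.ofReal C * ∫⁻ z, ‖f z‖ₑ ^ 2 ∂dA) := by
        rw [ENNReal.ofReal_mul hr.le, mul_assoc]
    _ ≤ ENNReal.ofReal r * ∫⁻ z in {z | z ∈ disk ∧ r < φ z}, ‖f z‖ₑ ^ 2 ∂dA := by
        gcongr
        exact h f hf
    _ = ∫⁻ z in {z | z ∈ disk ∧ r < φ z}, ENNReal.ofReal r * ‖f z‖ₑ ^ 2 ∂dA := by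
        rw [lintegral_const_mul' _ _ ENNReal.ofReal_ne_top]
    _ ≤ ∫⁻ z in {z | z ∈ disk ∧ r < φ z}, ENNReal.ofReal (φ z) * ‖f z‖ₑ ^ 2 ∂dA := by
        refine setLIntegral_mono' hG fun z hz => ?_
        gcongr
        exact hz.2.le
    _ ≤ _ := setLIntegral_le_lintegral _ _

/-! ### Pseudo-hyperbolic disks -/

theorem rho_eq (z w : ℂ) : rho z w = ‖mobius z w‖ := by
  rw [rho, mobius, norm_div, norm_div, norm_one_sub_conj_mul_comm, norm_sub_rev]

theorem mobius_mem_pseudoDisk_iff {z u : ℂ} (hz : z ∈ disk) (hu : u ∈ disk) {r : ℝ} :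
    mobius z u ∈ pseudoDisk z r ↔ u ∈ Metric.ball 0 r := by
  simp [pseudoDisk, rho_eq, mobius_mobius hz hu, mobius_mem_disk hz hu]

theorem measurable_mobius (z : ℂ) : Measurable (mobius z) := by
  unfold mobius
  fun_prop

theorem measurableSet_pseudoDisk (z : ℂ) (r : ℝ) : MeasurableSet (pseudoDisk z r) := by
  have : pseudoDisk z r = disk ∩ {w | ‖mobius z w‖ < r} := by
    simp only [← rho_eq]
    rfl
  rw [this]
  exact measurableSet_disk.inter (measurableSet_lt (measurable_mobius z).norm measurable_const)

theorem setLIntegral_pseudoDisk {z : ℂ} (hz : z ∈ disk) (r : ℝ) (g : ℂ → ℝ≥0∞) :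
    ∫⁻ w in pseudoDisk z r, g w ∂dA =
      ∫⁻ u in Metric.ball 0 r, ENNReal.ofReal (jac z u) * g (mobius z u) ∂dA := by
  rw [← lintegral_indicator (measurableSet_pseudoDisk z r),
    ← lintegral_indicator Metric.isOpen_ball.measurableSet, lintegral_eq_lintegral_mobius hz]
  refine lintegral_congr_ae ?_
  filter_upwards [ae_mem_disk] with u hu
  by_cases h : u ∈ Metric.ball 0 r
  · rw [Set.indicator_of_mem h, Set.indicator_of_mem ((mobius_mem_pseudoDisk_iff hz hu).2 h)]
  · rw [Set.indicator_of_notMem h,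
      Set.indicator_of_notMem (mt (mobius_mem_pseudoDisk_iff hz hu).1 h), mul_zero]

/-- Together with `jac_le_of_mem_ball`, this makes the Jacobian comparable to `(1 - |z|²)²` on a
ball of radius `r < 1`, uniformly in `z`. Relative sizes in a pseudo-hyperbolic disk can thus be
read off in the ball. -/
theorem jac_ge {z u : ℂ} (hz : z ∈ disk) (hu : u ∈ disk) : (1 - ‖z‖ ^ 2) ^ 2 / 16 ≤ jac z u := by
  have h := norm_one_sub_pos hz hu
  have h1 : ‖1 - conj z * u‖ ^ 4 ≤ 2 ^ 4 := by
    gcongr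
    exact norm_one_sub_le_two hz hu
  rw [jac]
  gcongr
  linarith

theorem jac_le_of_mem_ball {z u : ℂ} (hz : z ∈ disk) {r : ℝ} (hr : r < 1)
    (hu : u ∈ Metric.ball 0 r) : jac z u ≤ (1 - ‖z‖ ^ 2) ^ 2 / (1 - r) ^ 4 := by
  have h1 : 0 < 1 - r := by linarith
  have h2 := one_sub_norm_le (u := u) hz
  rw [mem_ball_zero_iff] at hu
  rw [jac]
  gcongr
  linarith

theorem setLIntegral_pseudoDisk_ge {z : ℂ} (hz : z ∈ disk) {r : ℝ} (hr : r < 1) (g : ℂ → ℝ≥0∞) :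
    ENNReal.ofReal ((1 - ‖z‖ ^ 2) ^ 2 / 16) * ∫⁻ u in Metric.ball 0 r, g (mobius z u) ∂dA ≤
      ∫⁻ w in pseudoDisk z r, g w ∂dA := by
  rw [setLIntegral_pseudoDisk hz, ← lintegral_const_mul' _ _ ENNReal.ofReal_ne_top]
  refine setLIntegral_mono' Metric.isOpen_ball.measurableSet fun u hu => ?_
  gcongr
  exact jac_ge hz (Metric.ball_subset_ball hr.le hu)

theorem setLIntegral_pseudoDisk_le {z : ℂ} (hz : z ∈ disk) {r : ℝ} (hr : r < 1) (g : ℂ → ℝ≥0∞) :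
    ∫⁻ w in pseudoDisk z r, g w ∂dA ≤ ENNReal.ofReal ((1 - ‖z‖ ^ 2) ^ 2 / (1 - r) ^ 4) *
      ∫⁻ u in Metric.ball 0 r, g (mobius z u) ∂dA := by
  rw [setLIntegral_pseudoDisk hz, ← lintegral_const_mul' _ _ ENNReal.ofReal_ne_top]
  refine setLIntegral_mono' Metric.isOpen_ball.measurableSet fun u hu => ?_
  gcongr
  exact jac_le_of_mem_ball hz hr hu

theorem dA_ball {r : ℝ} (hr0 : 0 ≤ r) (hr : r ≤ 1) :
    dA (Metric.ball 0 r) = ENNReal.ofReal (r ^ 2) := by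
  have h1 : Metric.ball (0 : ℂ) r ∩ disk = Metric.ball 0 r :=
    Set.inter_eq_left.2 (Metric.ball_subset_ball hr)
  apply pi_cancel
  rw [← setLIntegral_one, ← lintegral_indicator Metric.isOpen_ball.measurableSet, ← lintegral_dA,
    lintegral_indicator Metric.isOpen_ball.measurableSet,
    Measure.restrict_restrict Metric.isOpen_ball.measurableSet, h1, setLIntegral_one,
    Complex.volume_ball, ← ENNReal.ofReal_pow hr0, mul_comm]
  congr 1
  rw [← NNReal.coe_real_pi, ENNReal.ofReal_coe_nnreal]

theorem dA_compl_ball {r : ℝ} (hr0 : 0 ≤ r) (hr : r ≤ 1) :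
    dA (Metric.ball 0 r)ᶜ = ENNReal.ofReal (1 - r ^ 2) := by
  rw [prob_compl_eq_one_sub Metric.isOpen_ball.measurableSet, dA_ball hr0 hr,
    ENNReal.ofReal_sub _ (by positivity), ENNReal.ofReal_one]

theorem measureOf_apply (φ : ℂ → ℝ) {s : Set ℂ} (hs : MeasurableSet s) :
    measureOf φ s = ∫⁻ w in s, ENNReal.ofReal (φ w) ∂dA :=
  withDensity_apply _ hs

theorem dA_pseudoDisk_ge {z : ℂ} (hz : z ∈ disk) {r : ℝ} (hr0 : 0 ≤ r) (hr : r < 1) :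
    ENNReal.ofReal ((1 - ‖z‖ ^ 2) ^ 2 / 16 * r ^ 2) ≤ dA (pseudoDisk z r) := by
  have h := setLIntegral_pseudoDisk_ge hz hr 1
  simp only [Pi.one_apply, setLIntegral_one] at h
  rwa [dA_ball hr0 hr.le, ← ENNReal.ofReal_mul (by positivity)] at h

theorem dA_pseudoDisk_le {z : ℂ} (hz : z ∈ disk) {r : ℝ} (hr : r < 1) :
    dA (pseudoDisk z r) ≤ ENNReal.ofReal ((1 - ‖z‖ ^ 2) ^ 2 / (1 - r) ^ 4) := by
  have h := setLIntegral_pseudoDisk_le hz hr 1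
  simp only [Pi.one_apply, setLIntegral_one] at h
  exact h.trans (mul_le_of_le_one_right' prob_le_one)

/-! ### From the Berezin transform to averages and superlevel sets -/

/-- The mean of `φ ∘ mobius z` is at least `δ`, and the complement of the ball of radius `r`
contributes at most `M(1 - r²)`. For `r` near `1` at least `δ / 2` remains in the ball. -/
theorem IsBoundedBelowOnDisk.reverseCarlesonCondition {φ : ℂ → ℝ} (hφ : Measurable φ)
    {M : ℝ} (hM0 : 0 < M) (hM : ∀ z, φ z ≤ M)
    (h : IsBoundedBelowOnDisk (berezin (measureOf φ))) :
    ReverseCarlesonCondition (measureOf φ) := by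
  obtain ⟨δ, hδ, h⟩ := h
  obtain ⟨r, hr0, hr1, hr⟩ : ∃ r : ℝ, 0 < r ∧ r < 1 ∧ M * (1 - r ^ 2) ≤ δ / 2 := by
    have ht : Tendsto (fun r : ℝ => M * (1 - r ^ 2)) (𝓝[<] 1) (𝓝 (M * (1 - 1 ^ 2))) :=
      (Continuous.tendsto (by fun_prop) _).mono_left nhdsWithin_le_nhds
    have h1 : ∀ᶠ r : ℝ in 𝓝[<] 1, M * (1 - r ^ 2) < δ / 2 :=
      ht.eventually_lt_const (by norm_num; linarith)
    obtain ⟨r, h2, h3⟩ := (h1.and (Ioo_mem_nhdsLT (zero_lt_one' ℝ))).exists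
    exact ⟨r, h3.1, h3.2, h2.le⟩
  have h1r : 0 < 1 - r := by linarith
  -- The product of the mass `δ / 2` in the ball, the factor `1 / 16` from the lower Jacobian bound
  -- and the `(1 - r) ^ 4` from the upper bound on the area.
  set c := δ * (1 - r) ^ 4 / 32 with hc
  have hc0 : 0 < c := by positivity
  have key : ∀ z ∈ disk, c * dA.real (pseudoDisk z r) ≤ (measureOf φ).real (pseudoDisk z r) ∧
      (measureOf φ).real (pseudoDisk z r) ≤ M * dA.real (pseudoDisk z r) := by
    intro z hz
    have hup : measureOf φ (pseudoDisk z r) ≤ ENNReal.ofReal (M * dA.real (pseudoDisk z r)) := by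
      rw [measureOf_apply _ (measurableSet_pseudoDisk z r), ENNReal.ofReal_mul hM0.le,
        ofReal_measureReal, ← setLIntegral_const]
      gcongr with w
      exact hM w
    have hb : ENNReal.ofReal δ ≤ ∫⁻ u, ENNReal.ofReal (φ (mobius z u)) ∂dA := by
      rw [lintegral_comp_mobius hz fun w => ENNReal.ofReal (φ w)]
      simp only [mul_comm (ENNReal.ofReal (jac z _))]
      rw [← ofReal_berezin hφ hM hz]
      refine ENNReal.ofReal_le_ofReal ?_
      simpa [abs_of_nonneg (berezin_nonneg _ z)] using h z hz
    have hb2 : ENNReal.ofReal (δ / 2) ≤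
        ∫⁻ u in Metric.ball 0 r, ENNReal.ofReal (φ (mobius z u)) ∂dA := by
      have h2 : ∫⁻ u in (Metric.ball 0 r)ᶜ, ENNReal.ofReal (φ (mobius z u)) ∂dA ≤
          ENNReal.ofReal (δ / 2) := by
        calc _ ≤ ∫⁻ u in (Metric.ball 0 r)ᶜ, ENNReal.ofReal M ∂dA := by
              gcongr with u
              exact hM _
          _ = ENNReal.ofReal (M * (1 - r ^ 2)) := by
              rw [setLIntegral_const, dA_compl_ball hr0.le hr1.le, ENNReal.ofReal_mul hM0.le]
          _ ≤ _ := ENNReal.ofReal_le_ofReal hr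
      rw [← lintegral_add_compl _ (Metric.isOpen_ball (x := (0 : ℂ)) (ε := r)).measurableSet] at hb
      have h3 : ENNReal.ofReal (δ / 2) + ENNReal.ofReal (δ / 2) = ENNReal.ofReal δ := by
        rw [← ENNReal.ofReal_add (by positivity) (by positivity), add_halves]
      rw [← h3] at hb
      exact (ENNReal.add_le_add_iff_right ENNReal.ofReal_ne_top).1
        (hb.trans (add_le_add le_rfl h2))
    have hlow : ENNReal.ofReal (c * dA.real (pseudoDisk z r)) ≤ measureOf φ (pseudoDisk z r) := by
      rw [measureOf_apply _ (measurableSet_pseudoDisk z r), ENNReal.ofReal_mul hc0.le,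
        ofReal_measureReal]
      calc ENNReal.ofReal c * dA (pseudoDisk z r)
          ≤ ENNReal.ofReal c * ENNReal.ofReal ((1 - ‖z‖ ^ 2) ^ 2 / (1 - r) ^ 4) := by
            gcongr
            exact dA_pseudoDisk_le hz hr1
        _ = ENNReal.ofReal ((1 - ‖z‖ ^ 2) ^ 2 / 16) * ENNReal.ofReal (δ / 2) := by
            rw [← ENNReal.ofReal_mul hc0.le, ← ENNReal.ofReal_mul (by positivity), hc]
            congr 1
            field_simp
            ring
        _ ≤ _ := by
            refine le_trans ?_ (setLIntegral_pseudoDisk_ge hz hr1 fun w => ENNReal.ofReal (φ w))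
            gcongr
    have hfin : measureOf φ (pseudoDisk z r) ≠ ∞ := (hup.trans_lt ENNReal.ofReal_lt_top).ne
    exact ⟨(ENNReal.ofReal_le_iff_le_toReal hfin).1 hlow,
      ENNReal.toReal_le_of_le_ofReal (by positivity) hup⟩
  refine ⟨r, hr0, hr1, max c⁻¹ M, by positivity, fun z hz => ?_⟩
  obtain ⟨h1, h2⟩ := key z hz
  have hpos : 0 < dA.real (pseudoDisk z r) := by
    have hz2 := one_sub_norm_sq_pos hz
    rw [measureReal_def, ENNReal.toReal_pos_iff]
    refine ⟨lt_of_lt_of_le ?_ (dA_pseudoDisk_ge hz hr0.le hr1), measure_lt_top _ _⟩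
    rw [ENNReal.ofReal_pos]
    positivity
  rw [le_div_iff₀ hpos, div_le_iff₀ hpos]
  constructor
  · refine le_trans ?_ h1
    gcongr
    exact inv_le_of_inv_le₀ hc0 (le_max_left _ _)
  · refine h2.trans ?_
    gcongr
    exact le_max_right _ _

/-- A Chebyshev argument: points with `φ ≤ C⁻¹ / 2` give at most half of the average, and `φ ≤ M` on
the others forces them to fill a fixed proportion. The estimate is carried to a ball about `0`,
where Jensen's inequality will be used. -/
theorem ReverseCarlesonCondition.exists_dA_ge {φ : ℂ → ℝ} (hφ : Measurable φ)
    {M : ℝ} (hM0 : 0 < M) (hM : ∀ z, φ z ≤ M) (h : ReverseCarlesonCondition (measureOf φ)) :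
    ∃ t : ℝ, 0 < t ∧ ∃ r : ℝ, 0 < r ∧ r < 1 ∧ ∃ δ : ℝ, 0 < δ ∧ ∀ z ∈ disk,
      ENNReal.ofReal δ ≤
        dA (Metric.ball 0 r ∩ mobius z ⁻¹' {w | w ∈ disk ∧ t < φ w}) := by
  obtain ⟨r, hr0, hr1, C, hC, h⟩ := h
  have h1r : 0 < 1 - r := by linarith
  have hG : MeasurableSet {w | w ∈ disk ∧ C⁻¹ / 2 < φ w} :=
    measurableSet_disk.inter (measurableSet_lt measurable_const hφ)
  set G := {w | w ∈ disk ∧ C⁻¹ / 2 < φ w} with hGdef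
  -- The proportion `C⁻¹ / (2M)` of the pseudo-hyperbolic disk, times the ratio `r²(1 - r)⁴ / 16` of
  -- the lower area bound to the upper Jacobian bound.
  refine ⟨C⁻¹ / 2, by positivity, r, hr0, hr1, C⁻¹ / 2 * (r ^ 2 * (1 - r) ^ 4 / (16 * M)),
    by positivity, fun z hz => ?_⟩
  have hz2 := one_sub_norm_sq_pos hz
  have hE := measurableSet_pseudoDisk z r
  set E := pseudoDisk z r
  have hA0 : (1 - ‖z‖ ^ 2) ^ 2 / 16 * r ^ 2 ≤ dA.real E := by
    refine (ENNReal.ofReal_le_iff_le_toReal (measure_ne_top _ _)).1 ?_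
    exact dA_pseudoDisk_ge hz hr0.le hr1
  have hpos : 0 < dA.real E := lt_of_lt_of_le (by positivity) hA0
  have h1 := (h z hz).1
  rw [le_div_iff₀ hpos] at h1
  have h2 : measureOf φ E ≤ ENNReal.ofReal (C⁻¹ / 2) * dA E + ENNReal.ofReal M * dA (G ∩ E) := by
    rw [measureOf_apply _ hE, ← setLIntegral_const, ← Measure.restrict_apply hG,
      ← lintegral_indicator_const hG, ← lintegral_add_left measurable_const]
    refine setLIntegral_mono' hE fun w hw => ?_
    by_cases hwG : w ∈ G
    · rw [Set.indicator_of_mem hwG]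
      exact (ENNReal.ofReal_le_ofReal (hM w)).trans le_add_self
    · rw [Set.indicator_of_notMem hwG, add_zero]
      refine ENNReal.ofReal_le_ofReal ?_
      by_contra! h3
      exact hwG ⟨hw.1, h3⟩
  have h3 : (measureOf φ).real E ≤ C⁻¹ / 2 * dA.real E + M * dA.real (G ∩ E) := by
    refine ENNReal.toReal_le_of_le_ofReal (by positivity) (h2.trans (le_of_eq ?_))
    rw [ENNReal.ofReal_add (by positivity) (by positivity), ENNReal.ofReal_mul (by positivity),
      ENNReal.ofReal_mul hM0.le, ofReal_measureReal, ofReal_measureReal]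
  have h4 : dA (G ∩ E) ≤ ENNReal.ofReal ((1 - ‖z‖ ^ 2) ^ 2 / (1 - r) ^ 4) *
      dA (Metric.ball 0 r ∩ mobius z ⁻¹' G) := by
    have h5 := setLIntegral_pseudoDisk_le hz hr1 (G.indicator 1)
    rw [lintegral_indicator_one hG, Measure.restrict_apply hG] at h5
    refine h5.trans (le_of_eq ?_)
    congr 1
    have h6 : ∀ u, G.indicator (1 : ℂ → ℝ≥0∞) (mobius z u) = (mobius z ⁻¹' G).indicator 1 u :=
      fun u => rfl
    simp only [h6]
    rw [lintegral_indicator_one (measurable_mobius z hG),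
      Measure.restrict_apply (measurable_mobius z hG), Set.inter_comm]
  have h5 : dA.real (G ∩ E) ≤ (1 - ‖z‖ ^ 2) ^ 2 / (1 - r) ^ 4 *
      dA.real (Metric.ball 0 r ∩ mobius z ⁻¹' G) := by
    refine ENNReal.toReal_le_of_le_ofReal (by positivity) (h4.trans (le_of_eq ?_))
    rw [ENNReal.ofReal_mul (by positivity), ofReal_measureReal]
  refine (ENNReal.ofReal_le_iff_le_toReal (measure_ne_top _ _)).2 ?_
  change _ ≤ dA.real (Metric.ball 0 r ∩ mobius z ⁻¹' G)
  set X := dA.real (Metric.ball 0 r ∩ mobius z ⁻¹' G)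
  have h6 : C⁻¹ / 2 * ((1 - ‖z‖ ^ 2) ^ 2 / 16 * r ^ 2) ≤
      M * ((1 - ‖z‖ ^ 2) ^ 2 / (1 - r) ^ 4 * X) := by
    have h7 : C⁻¹ / 2 * ((1 - ‖z‖ ^ 2) ^ 2 / 16 * r ^ 2) ≤ C⁻¹ / 2 * dA.real E := by gcongr
    have h8 : M * dA.real (G ∩ E) ≤ M * ((1 - ‖z‖ ^ 2) ^ 2 / (1 - r) ^ 4 * X) := by gcongr
    linarith
  have h9 : 0 < M * ((1 - ‖z‖ ^ 2) ^ 2 / (1 - r) ^ 4) := by positivity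
  rw [← mul_assoc M] at h6
  refine le_of_mul_le_mul_left (le_trans (le_of_eq ?_) h6) h9
  field_simp

/-! ### Jensen's inequality and the size of sets where an analytic function is small -/

/-- In Jensen's formula each zero `u` in the closed disk contributes its multiplicity times `log (ρ
/ |u|) ≥ 0`. -/
theorem log_norm_le_circleAverage {g : ℂ → ℂ} {ρ : ℝ} (hρ : 0 < ρ)
    (hg : AnalyticOnNhd ℂ g (Metric.closedBall 0 |ρ|)) (h0 : g 0 ≠ 0) :
    Real.log ‖g 0‖ ≤ Real.circleAverage (fun w => Real.log ‖g w‖) 0 ρ := by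
  rw [hg.circleAverage_log_norm hρ.ne' h0]
  refine le_add_of_nonneg_left (finsum_nonneg fun u => ?_)
  by_cases hu : u ∈ Metric.closedBall (0 : ℂ) |ρ|
  · refine mul_nonneg (mod_cast MeromorphicOn.AnalyticOnNhd.divisor_nonneg hg u) ?_
    -- At the origin the logarithmic factor is `0`, because `0⁻¹ = 0` and `Real.log 0 = 0`.
    rcases eq_or_ne u 0 with rfl | hu0
    · simp
    · rw [zero_sub, norm_neg]
      refine Real.log_nonneg ?_
      rw [mem_closedBall_zero_iff, abs_of_pos hρ] at hu
      rwa [← div_eq_mul_inv, one_le_div (norm_pos_iff.2 hu0)]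
  · simp [hu]

/-- Zeros are isolated. They must be discarded before comparing logarithms, since the convention
`Real.log 0 = 0` breaks monotonicity there. -/
theorem ae_circleMap_ne_zero {g : ℂ → ℂ} {ρ : ℝ} (hρ : 0 < ρ)
    (hg : AnalyticOnNhd ℂ g (Metric.closedBall 0 |ρ|)) (h0 : g 0 ≠ 0) :
    ∀ᵐ θ : ℝ, g (circleMap 0 ρ θ) ≠ 0 := by
  have h1 : g ⁻¹' {0}ᶜ ∈ codiscreteWithin (Metric.closedBall 0 |ρ|) :=
    hg.preimage_zero_mem_codiscreteWithin h0 (by simp)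
      ((convex_closedBall 0 |ρ|).isConnected ⟨0, by simp⟩)
  have h2 := circleMap_preimage_codiscrete hρ.ne'
    (codiscreteWithin_mono Metric.sphere_subset_closedBall h1)
  have h3 := ae_restrict_le_codiscreteWithin (μ := (volume : Measure ℝ)) MeasurableSet.univ h2
  rwa [Measure.restrict_univ] at h3

/-- An analytic function that is one at the center of a disk and bounded by `B` is small only on
a small part of each circle around the center. -/
theorem volume_circle_small_le {g : ℂ → ℂ} {ρ B η : ℝ} (hρ : 0 < ρ)
    (hg : AnalyticOnNhd ℂ g (Metric.closedBall 0 |ρ|)) (h0 : g 0 = 1)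
    (hB : ∀ w ∈ Metric.sphere 0 ρ, ‖g w‖ ≤ B) :
    (Real.log B - Real.log η) *
      volume.real (Set.Ioo (-Real.pi) Real.pi ∩ {θ | ‖g (circleMap 0 ρ θ)‖ < η}) ≤
      2 * Real.pi * Real.log B := by
  have hpi := Real.pi_pos
  have hcont : Continuous fun θ => g (circleMap 0 ρ θ) := by
    refine hg.continuousOn.comp_continuous (continuous_circleMap 0 ρ) fun θ => ?_
    exact Metric.sphere_subset_closedBall (by
      rw [abs_of_pos hρ]; exact circleMap_mem_sphere 0 hρ.le θ)
  have hS : MeasurableSet {θ | ‖g (circleMap 0 ρ θ)‖ < η} :=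
    (isOpen_lt hcont.norm continuous_const).measurableSet
  set S := {θ | ‖g (circleMap 0 ρ θ)‖ < η} with hSdef
  have hint0 : CircleIntegrable (fun w => Real.log ‖g w‖) 0 ρ :=
    (hg.mono Metric.sphere_subset_closedBall).meromorphicOn.circleIntegrable_log_norm
  have hper : Function.Periodic (fun θ => Real.log ‖g (circleMap 0 ρ θ)‖) (2 * Real.pi) :=
    (periodic_circleMap 0 ρ).comp fun w => Real.log ‖g w‖
  have hint : IntegrableOn (fun θ => Real.log ‖g (circleMap 0 ρ θ)‖)
      (Set.Ioo (-Real.pi) Real.pi) := by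
    have h := hper.intervalIntegrable₀ (by positivity) hint0 (-Real.pi) Real.pi
    rw [intervalIntegrable_iff_integrableOn_Ioo_of_le (by linarith)] at h
    exact h
  have havg : 0 ≤ ∫ θ in Set.Ioo (-Real.pi) Real.pi, Real.log ‖g (circleMap 0 ρ θ)‖ := by
    have h := log_norm_le_circleAverage hρ hg (by simp [h0])
    rw [h0, norm_one, Real.log_one, Real.circleAverage_eq_integral_add (-Real.pi),
      intervalIntegral.integral_comp_add_right
        (fun θ => Real.log ‖g (circleMap 0 ρ θ)‖)] at h
    have e1 : (0 : ℝ) + -Real.pi = -Real.pi := by ring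
    have e2 : 2 * Real.pi + -Real.pi = Real.pi := by ring
    rw [e1, e2, intervalIntegral.integral_of_le (by linarith), integral_Ioc_eq_integral_Ioo,
      smul_eq_mul] at h
    exact (mul_nonneg_iff_of_pos_left (by positivity)).1 h
  -- The logarithm is at most `log B` everywhere and at most `log η` on `S`; as its integral is
  -- nonnegative, `S` cannot be long.
  have hle : ∫ θ in Set.Ioo (-Real.pi) Real.pi, Real.log ‖g (circleMap 0 ρ θ)‖ ≤
      ∫ θ in Set.Ioo (-Real.pi) Real.pi,
        (Real.log B - S.indicator (fun _ => Real.log B - Real.log η) θ) := by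
    refine integral_mono_ae hint ?_ ?_
    · exact (integrable_const _).sub ((integrable_const _).indicator hS)
    · filter_upwards [ae_restrict_of_ae (ae_circleMap_ne_zero hρ hg (by simp [h0]))] with θ hθ
      have hθ' := norm_pos_iff.2 hθ
      by_cases h : θ ∈ S
      · rw [Set.indicator_of_mem h, sub_sub_cancel]
        exact Real.log_le_log hθ' (le_of_lt h)
      · rw [Set.indicator_of_notMem h, sub_zero]
        exact Real.log_le_log hθ' (hB _ (circleMap_mem_sphere 0 hρ.le θ))
  rw [integral_sub (integrable_const _) ((integrable_const _).indicator hS), integral_const,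
    integral_indicator hS, integral_const, smul_eq_mul, smul_eq_mul] at hle
  simp only [measureReal_restrict_apply MeasurableSet.univ,
    Measure.restrict_restrict hS, Set.univ_inter, Real.volume_real_Ioo] at hle
  rw [max_eq_left (by linarith), Set.inter_comm] at hle
  nlinarith

theorem analyticOnNhd_of_differentiableOn_disk {g : ℂ → ℂ} (hg : DifferentiableOn ℂ g disk) :
    AnalyticOnNhd ℂ g disk :=
  hg.analyticOnNhd isOpen_disk

/-- An analytic function that is one at the center of a disk and bounded by `B` is small only on
a small part of the disk. -/
theorem dA_small_le {g : ℂ → ℂ} (hg : DifferentiableOn ℂ g disk) {r B η : ℝ} (hr : r < 1)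
    (h0 : g 0 = 1) (hη : 0 < η) (hηB : η < B) (hB1 : 1 ≤ B)
    (hB : ∀ w ∈ Metric.ball 0 r, ‖g w‖ ≤ B) :
    dA (Metric.ball 0 r ∩ {w | ‖g w‖ < η}) ≤
      ENNReal.ofReal (2 * (Real.log B / (Real.log B - Real.log η))) := by
  have hpi := Real.pi_pos
  have hT : 0 < Real.log B - Real.log η := sub_pos.2 (Real.log_lt_log hη hηB)
  have hL : 0 ≤ Real.log B := Real.log_nonneg hB1
  set κ := Real.log B / (Real.log B - Real.log η) with hκ
  have hκ0 : 0 ≤ κ := div_nonneg hL hT.le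
  have hsub : Metric.ball (0 : ℂ) r ⊆ disk := Metric.ball_subset_ball hr.le
  have hopen : IsOpen (Metric.ball (0 : ℂ) r ∩ {w | ‖g w‖ < η}) :=
    ((hg.continuousOn.mono hsub).norm).isOpen_inter_preimage Metric.isOpen_ball isOpen_Iio
  set A := Metric.ball (0 : ℂ) r ∩ {w | ‖g w‖ < η} with hA
  have hAm := hopen.measurableSet
  have hpol : Measurable fun p : ℝ × ℝ => Complex.polarCoord.symm p := by
    simp only [Complex.polarCoord_symm_apply]
    fun_prop
  have hmap : ∀ ρ θ : ℝ, Complex.polarCoord.symm (ρ, θ) = circleMap 0 ρ θ := by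
    intro ρ θ
    rw [Complex.polarCoord_symm_apply, circleMap, Complex.exp_mul_I]
    simp
  have hind : Measurable (A.indicator (1 : ℂ → ℝ≥0∞)) := measurable_one.indicator hAm
  -- Each circle meets `A` in angular measure at most `2πκ`. The polar weight `ρ` is simply bounded
  -- by `1`, so the total area is at most `2πκ`, that is `2κ` for `dA`.
  have hcirc : ∀ ρ ∈ Set.Ioi (0 : ℝ),
      ∫⁻ θ in Set.Ioo (-Real.pi) Real.pi,
        ENNReal.ofReal ρ • A.indicator (1 : ℂ → ℝ≥0∞) (Complex.polarCoord.symm (ρ, θ)) ≤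
      (Set.Ioo (0 : ℝ) 1).indicator (fun _ => ENNReal.ofReal (2 * Real.pi * κ)) ρ := by
    intro ρ hρ
    have hρ0 : 0 < ρ := hρ
    have hnorm : ∀ θ, ‖Complex.polarCoord.symm (ρ, θ)‖ = ρ := fun θ => by
      rw [Complex.norm_polarCoord_symm, abs_of_pos hρ0]
    by_cases hρr : ρ < r
    · rw [Set.indicator_of_mem (show ρ ∈ Set.Ioo (0 : ℝ) 1 from ⟨hρ0, hρr.trans hr⟩)]
      have hsub2 : Metric.closedBall (0 : ℂ) |ρ| ⊆ disk := by
        rw [abs_of_pos hρ0]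
        exact Metric.closedBall_subset_ball (hρr.trans hr)
      have hv := volume_circle_small_le hρ0
        ((analyticOnNhd_of_differentiableOn_disk hg).mono hsub2) h0 (B := B) (η := η) (by
          intro w hw
          refine hB w ?_
          rw [mem_sphere_zero_iff_norm] at hw
          rwa [mem_ball_zero_iff, hw])
      have hrew : ∀ θ, A.indicator (1 : ℂ → ℝ≥0∞) (Complex.polarCoord.symm (ρ, θ)) =
          {θ | ‖g (circleMap 0 ρ θ)‖ < η}.indicator 1 θ := by
        intro θ
        have h1 : Complex.polarCoord.symm (ρ, θ) ∈ Metric.ball (0 : ℂ) r := by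
          rwa [mem_ball_zero_iff, hnorm]
        have h2 : Complex.polarCoord.symm (ρ, θ) ∈ A ↔ ‖g (circleMap 0 ρ θ)‖ < η := by
          rw [hmap] at h1 ⊢
          exact and_iff_right h1
        classical simp only [Set.indicator_apply, h2, Set.mem_ofPred_eq, Pi.one_apply]
      have hS : MeasurableSet {θ | ‖g (circleMap 0 ρ θ)‖ < η} := by
        have hc : Continuous fun θ => g (circleMap 0 ρ θ) :=
          hg.continuousOn.comp_continuous (continuous_circleMap 0 ρ) fun θ => by
            rw [← hmap, mem_disk, hnorm]
            exact hρr.trans hr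
        exact (isOpen_lt hc.norm continuous_const).measurableSet
      simp only [hrew, smul_eq_mul]
      rw [lintegral_const_mul _ (measurable_one.indicator hS), lintegral_indicator_one hS,
        Measure.restrict_apply hS, Set.inter_comm]
      calc _ ≤ 1 * volume (Set.Ioo (-Real.pi) Real.pi ∩ {θ | ‖g (circleMap 0 ρ θ)‖ < η}) := by
            gcongr
            rw [ENNReal.ofReal_le_one]
            linarith
        _ = ENNReal.ofReal (volume.real
            (Set.Ioo (-Real.pi) Real.pi ∩ {θ | ‖g (circleMap 0 ρ θ)‖ < η})) := by
            rw [one_mul, ofReal_measureReal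
              ((measure_mono Set.inter_subset_left).trans_lt (by simp)).ne]
        _ ≤ _ := by
            refine ENNReal.ofReal_le_ofReal ?_
            rw [hκ, mul_div_assoc', le_div_iff₀ hT, mul_comm]
            exact hv
    · refine le_trans (le_of_eq ?_) zero_le
      refine (lintegral_congr fun θ => ?_).trans lintegral_zero
      rw [Set.indicator_of_notMem, smul_zero]
      intro h
      have := h.1
      rw [mem_ball_zero_iff, hnorm] at this
      exact hρr this
  have hvol : volume A ≤ ENNReal.ofReal (2 * Real.pi * κ) := by
    rw [← lintegral_indicator_one hAm, ← Complex.lintegral_comp_polarCoord_symm,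
      polarCoord_target, Measure.volume_eq_prod, ← Measure.prod_restrict, lintegral_prod _
        (by
          simp only [smul_eq_mul]
          exact ((measurable_fst.ennreal_ofReal).mul (hind.comp hpol)).aemeasurable)]
    calc _ ≤ ∫⁻ ρ in Set.Ioi (0 : ℝ),
          (Set.Ioo (0 : ℝ) 1).indicator (fun _ => ENNReal.ofReal (2 * Real.pi * κ)) ρ :=
          setLIntegral_mono' measurableSet_Ioi hcirc
      _ ≤ ∫⁻ ρ, (Set.Ioo (0 : ℝ) 1).indicator (fun _ => ENNReal.ofReal (2 * Real.pi * κ)) ρ :=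
          setLIntegral_le_lintegral _ _
      _ = _ := by
          rw [lintegral_indicator_const measurableSet_Ioo, Real.volume_Ioo]
          simp
  have h1 : ENNReal.ofReal Real.pi * dA A = volume A := by
    rw [← lintegral_indicator_one hAm, ← lintegral_dA, lintegral_indicator_one hAm,
      Measure.restrict_apply hAm, Set.inter_eq_left.2 (Set.inter_subset_left.trans hsub)]
  refine (ENNReal.mul_le_mul_iff_right (a := ENNReal.ofReal Real.pi) (by simp [hpi])
    ENNReal.ofReal_ne_top).1 ?_
  rw [h1, ← ENNReal.ofReal_mul hpi.le]
  refine hvol.trans (le_of_eq ?_)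
  congr 1
  ring

/-! ### Local estimates at the center of the disk -/

theorem eLpNorm_two_sq (f : ℂ → ℂ) : eLpNorm f 2 dA ^ 2 = ∫⁻ z, ‖f z‖ₑ ^ 2 ∂dA := by
  rw [eLpNorm_eq_lintegral_rpow_enorm_toReal (by norm_num) (by norm_num)]
  rw [← ENNReal.rpow_natCast, ← ENNReal.rpow_mul]
  simp

/-- Points well inside the disk are bounded evaluations for a weighted `L^2` norm. -/
theorem exists_enorm_sq_le {r : ℝ} (hr0 : 0 < r) (hr : r < 1) :
    ∃ K : ℝ, 0 < K ∧ ∀ g : ℂ → ℂ, DifferentiableOn ℂ g disk → ∀ u ∈ Metric.ball (0 : ℂ) r,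
      ‖g u‖ₑ ^ 2 ≤ ENNReal.ofReal K *
        ∫⁻ w, ENNReal.ofReal ((1 - ‖w‖ ^ 2) ^ 2) * ‖g w‖ₑ ^ 2 ∂dA := by
  -- Dilating by `R` confines the integral to the ball of radius `R`, where the weight is at least
  -- `(1 - R²)²`. As `r < R`, the point `u / R` keeps the distance `s` from the unit circle that
  -- `point_bound` requires.
  set R := (1 + r) / 2 with hR
  have hR0 : 0 < R := by rw [hR]; linarith
  have hR1 : R < 1 := by rw [hR]; linarith
  have hrR : r < R := by rw [hR]; linarith
  have hq : r / R < 1 := (div_lt_one hR0).2 hrR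
  set s := (1 - r / R) / 2 with hs
  have hs0 : 0 < s := by rw [hs]; linarith
  have hR2 : 0 < 1 - R ^ 2 := by nlinarith
  refine ⟨((s ^ 2 / 2) ^ 2)⁻¹ * ((R ^ 2)⁻¹ * ((1 - R ^ 2) ^ 2)⁻¹), by positivity,
    fun g hg u hu => ?_⟩
  have hmem : ∀ w ∈ disk, (R : ℂ) * w ∈ Metric.ball (0 : ℂ) R := by
    intro w hw
    rw [mem_disk] at hw
    rw [mem_ball_zero_iff, norm_mul, Complex.norm_real, Real.norm_of_nonneg hR0.le]
    nlinarith
  have hsub : Metric.ball (0 : ℂ) R ⊆ disk := Metric.ball_subset_ball hR1.le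
  have hRc : (R : ℂ) ≠ 0 := by exact_mod_cast hR0.ne'
  have hh : DifferentiableOn ℂ (fun w => g (R * w)) disk :=
    hg.comp (by fun_prop) fun w hw => hsub (hmem w hw)
  have hun : ‖u / R‖ + s < 1 := by
    rw [mem_ball_zero_iff] at hu
    rw [norm_div, Complex.norm_real, Real.norm_of_nonneg hR0.le]
    have : ‖u‖ / R < r / R := by gcongr
    rw [hs]
    linarith
  have hpb := point_bound hh hs0 hun
  rw [mul_div_cancel₀ _ hRc] at hpb
  have hpb2 : ENNReal.ofReal ((s ^ 2 / 2) ^ 2) * ‖g u‖ₑ ^ 2 ≤ ∫⁻ w, ‖g (R * w)‖ₑ ^ 2 ∂dA := by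
    rw [← eLpNorm_two_sq, ENNReal.ofReal_pow (by positivity), ← mul_pow]
    gcongr
  have himg : (fun w : ℂ => (R : ℂ) * w) '' disk ⊆ disk := by
    rintro _ ⟨w, hw, rfl⟩
    exact hsub (hmem w hw)
  have hscale : ENNReal.ofReal (R ^ 2 * (1 - R ^ 2) ^ 2) * ∫⁻ w, ‖g (R * w)‖ₑ ^ 2 ∂dA ≤
      ∫⁻ w, ENNReal.ofReal ((1 - ‖w‖ ^ 2) ^ 2) * ‖g w‖ₑ ^ 2 ∂dA := by
    refine (ENNReal.mul_le_mul_iff_right (a := ENNReal.ofReal Real.pi)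
      (by simp [Real.pi_pos]) ENNReal.ofReal_ne_top).1 ?_
    rw [mul_left_comm, ← lintegral_dA, ← lintegral_dA,
      ← lintegral_const_mul' _ _ ENNReal.ofReal_ne_top]
    refine le_trans ?_ (lintegral_mono_set himg)
    rw [setLIntegral_image_of_hasDerivAt (p' := fun _ => (R : ℂ)) measurableSet_disk
      (fun w _ => by simpa using (hasDerivAt_id w).const_mul (R : ℂ))
      (fun a _ b _ hab => mul_left_cancel₀ hRc hab)]
    refine setLIntegral_mono' measurableSet_disk fun w hw => ?_
    rw [Complex.norm_real, Real.norm_of_nonneg hR0.le, ← mul_assoc,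
      ← ENNReal.ofReal_mul (by positivity)]
    have h1 := hmem w hw
    rw [mem_ball_zero_iff] at h1
    gcongr
  have hK : ∀ {a : ℝ}, 0 < a → ∀ {x y : ℝ≥0∞}, ENNReal.ofReal a * x ≤ y →
      x ≤ ENNReal.ofReal a⁻¹ * y := by
    intro a ha x y hxy
    calc x = ENNReal.ofReal a⁻¹ * (ENNReal.ofReal a * x) := by
          rw [← mul_assoc, ← ENNReal.ofReal_mul (by positivity), inv_mul_cancel₀ ha.ne',
            ENNReal.ofReal_one, one_mul]
      _ ≤ _ := by gcongr
  have h1 := hK (by positivity) hpb2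
  have h2 := hK (by positivity) hscale
  rw [ENNReal.ofReal_mul (by positivity), mul_assoc, ← mul_inv]
  exact h1.trans (mul_le_mul' le_rfl h2)

/-- If the value of an analytic function at the center is comparable with its weighted `L^2` norm,
then it is dominated by the `L^2` norm over any set of given positive area. -/
theorem exists_mul_enorm_sq_le {r δ ε : ℝ} (hr0 : 0 < r) (hr : r < 1) (hδ : 0 < δ) (hε : 0 < ε) :
    ∃ c : ℝ, 0 < c ∧ ∀ g : ℂ → ℂ, DifferentiableOn ℂ g disk →
      ENNReal.ofReal ε * ∫⁻ w, ENNReal.ofReal ((1 - ‖w‖ ^ 2) ^ 2) * ‖g w‖ₑ ^ 2 ∂dA ≤ ‖g 0‖ₑ ^ 2 →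
      ∀ S : Set ℂ, MeasurableSet S → ENNReal.ofReal δ ≤ dA (Metric.ball 0 r ∩ S) →
      ENNReal.ofReal c * ‖g 0‖ₑ ^ 2 ≤ ∫⁻ w in Metric.ball 0 r ∩ S, ‖g w‖ₑ ^ 2 ∂dA := by
  obtain ⟨K, hK0, hK⟩ := exists_enorm_sq_le hr0 hr
  -- The hypothesis gives `|g / g(0)|² ≤ K / ε` on the ball; adding `2` ensures both `B² ≥ K / ε`
  -- and `log B > 0`.
  set B := 2 + K / ε with hB
  have hKε : 0 < K / ε := by positivity
  have hB1 : 1 < B := by rw [hB]; linarith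
  have hL : 0 < Real.log B := Real.log_pos hB1
  -- Chosen so that `log B - log η = 4 log B / δ`; the set where `|g / g(0)| < η` then has area at
  -- most `δ / 2`, leaving at least `δ / 2` of the given set.
  set η := B * Real.exp (-(4 * Real.log B / δ)) with hη
  have hη0 : 0 < η := by positivity
  have hlog : Real.log B - Real.log η = 4 * Real.log B / δ := by
    rw [hη, Real.log_mul (by positivity) (Real.exp_pos _).ne', Real.log_exp]
    ring
  have hηB : η < B := by
    rw [hη]
    have : Real.exp (-(4 * Real.log B / δ)) < 1 := by
      rw [Real.exp_lt_one_iff]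
      have : 0 < 4 * Real.log B / δ := by positivity
      linarith
    nlinarith
  have hκ : 2 * (Real.log B / (Real.log B - Real.log η)) = δ / 2 := by
    rw [hlog]
    field_simp
    ring
  refine ⟨η ^ 2 * (δ / 2), by positivity, fun g hg hgood S hS hSδ => ?_⟩
  rcases eq_or_ne (g 0) 0 with h0 | h0
  · simp [h0]
  have hn0 : 0 < ‖g 0‖ := norm_pos_iff.2 h0
  have hsub : Metric.ball (0 : ℂ) r ⊆ disk := Metric.ball_subset_ball hr.le
  have hbound : ∀ w ∈ Metric.ball (0 : ℂ) r, ‖g w / g 0‖ ≤ B := by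
    intro w hw
    have h1 : ENNReal.ofReal ε * ‖g w‖ₑ ^ 2 ≤ ENNReal.ofReal K * ‖g 0‖ₑ ^ 2 := by
      calc _ ≤ ENNReal.ofReal ε * (ENNReal.ofReal K *
            ∫⁻ w, ENNReal.ofReal ((1 - ‖w‖ ^ 2) ^ 2) * ‖g w‖ₑ ^ 2 ∂dA) := by
            gcongr
            exact hK g hg w hw
        _ ≤ _ := by
            rw [mul_left_comm]
            gcongr
    simp only [← ofReal_norm, ← ENNReal.ofReal_pow (norm_nonneg _)] at h1
    rw [← ENNReal.ofReal_mul hε.le, ← ENNReal.ofReal_mul hK0.le,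
      ENNReal.ofReal_le_ofReal_iff (by positivity)] at h1
    rw [norm_div, div_le_iff₀ hn0]
    refine abs_le_of_sq_le_sq' ?_ (by positivity) |>.2
    have h2 : ‖g w‖ ^ 2 ≤ K / ε * ‖g 0‖ ^ 2 := by
      rw [div_mul_eq_mul_div, le_div_iff₀ hε]
      linarith
    refine h2.trans ?_
    rw [mul_pow]
    gcongr
    rw [hB]
    nlinarith
  have hsmall := dA_small_le (hg.div_const (g 0)) hr (div_self h0) hη0 hηB hB1.le hbound
  rw [hκ] at hsmall
  have hopen : IsOpen (Metric.ball (0 : ℂ) r ∩ {w | ‖g w / g 0‖ < η}) :=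
    (((hg.div_const (g 0)).continuousOn.mono hsub).norm).isOpen_inter_preimage
      Metric.isOpen_ball isOpen_Iio
  set A := Metric.ball (0 : ℂ) r ∩ {w | ‖g w / g 0‖ < η} with hA
  have hlarge : ENNReal.ofReal (δ / 2) ≤ dA ((Metric.ball 0 r ∩ S) \ A) := by
    have h1 : dA (Metric.ball 0 r ∩ S) ≤ dA ((Metric.ball 0 r ∩ S) \ A) + dA A :=
      (measure_mono (Set.subset_sdiff_union _ _)).trans (measure_union_le _ _)
    have h3 : ENNReal.ofReal (δ / 2) + ENNReal.ofReal (δ / 2) = ENNReal.ofReal δ := by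
      rw [← ENNReal.ofReal_add (by positivity) (by positivity), add_halves]
    rw [← ENNReal.add_le_add_iff_right (a := ENNReal.ofReal (δ / 2)) ENNReal.ofReal_ne_top, h3]
    exact (hSδ.trans h1).trans (add_le_add le_rfl hsmall)
  have hbm : MeasurableSet (Metric.ball (0 : ℂ) r) := Metric.isOpen_ball.measurableSet
  calc ENNReal.ofReal (η ^ 2 * (δ / 2)) * ‖g 0‖ₑ ^ 2
      = ENNReal.ofReal (η ^ 2 * ‖g 0‖ ^ 2) * ENNReal.ofReal (δ / 2) := by
        rw [← ofReal_norm, ← ENNReal.ofReal_pow (norm_nonneg _),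
          ← ENNReal.ofReal_mul (by positivity), ← ENNReal.ofReal_mul (by positivity)]
        congr 1
        ring
    _ ≤ ENNReal.ofReal (η ^ 2 * ‖g 0‖ ^ 2) * dA ((Metric.ball 0 r ∩ S) \ A) := by gcongr
    _ = ∫⁻ w in (Metric.ball 0 r ∩ S) \ A, ENNReal.ofReal (η ^ 2 * ‖g 0‖ ^ 2) ∂dA := by
        rw [setLIntegral_const]
    _ ≤ ∫⁻ w in (Metric.ball 0 r ∩ S) \ A, ‖g w‖ₑ ^ 2 ∂dA := by
        refine setLIntegral_mono' ((hbm.inter hS).diff hopen.measurableSet) fun w hw => ?_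
        have h1 : η ≤ ‖g w / g 0‖ := by
          by_contra! h
          exact hw.2 ⟨hw.1.1, h⟩
        rw [norm_div, le_div_iff₀ hn0] at h1
        rw [← ofReal_norm, ← ENNReal.ofReal_pow (norm_nonneg _), ← mul_pow]
        gcongr
    _ ≤ _ := lintegral_mono_set Set.sdiff_subset

/-! ### Weighted means and Luecking's theorem -/

/-- The weighted average of `h` over the disk, moved to `z` by `mobius z`. -/
def weightedMean (h : ℂ → ℝ≥0∞) (z : ℂ) : ℝ≥0∞ :=
  ∫⁻ u, ENNReal.ofReal ((1 - ‖u‖ ^ 2) ^ 2) * h (mobius z u) ∂dA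

/-- The kernel of `weightedMean`. -/
def meanKernel (z w : ℂ) : ℝ := jac z w * (1 - ‖mobius z w‖ ^ 2) ^ 2

theorem measurable_meanKernel : Measurable fun p : ℂ × ℂ => meanKernel p.1 p.2 := by
  unfold meanKernel jac mobius
  refine Measurable.mul ?_ ?_ <;> fun_prop

theorem measurable_meanKernel_left (w : ℂ) : Measurable fun z => meanKernel z w := by
  unfold meanKernel jac mobius
  refine Measurable.mul ?_ ?_ <;> fun_prop

theorem weightedMean_eq {z : ℂ} (hz : z ∈ disk) (h : ℂ → ℝ≥0∞) :
    weightedMean h z = ∫⁻ w, ENNReal.ofReal (meanKernel z w) * h w ∂dA := by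
  have h1 := lintegral_comp_mobius hz
    fun w => ENNReal.ofReal ((1 - ‖mobius z w‖ ^ 2) ^ 2) * h w
  simp only [← mul_assoc, ← ENNReal.ofReal_mul (jac_nonneg z _)] at h1
  unfold meanKernel
  rw [← h1]
  refine lintegral_congr_ae ?_
  filter_upwards [ae_mem_disk] with u hu
  rw [mobius_mobius hz hu]

theorem measurable_weightedMean {h : ℂ → ℝ≥0∞} (hh : Measurable h) :
    Measurable (weightedMean h) := by
  have hm : Measurable fun p : ℂ × ℂ => mobius p.1 p.2 := by
    unfold mobius
    fun_prop
  refine Measurable.lintegral_prod_right'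
    (f := fun p : ℂ × ℂ => ENNReal.ofReal ((1 - ‖p.2‖ ^ 2) ^ 2) * h (mobius p.1 p.2)) ?_
  exact Measurable.mul (by fun_prop) (hh.comp hm)

/-- The kernel equals `((1 - |z|²) / |1 - z̄w|)⁴ * jac w z`, and the ratio is at most `2`. This
trades `jac z w` for `jac w z`, which has unit mass in `z`. The weight in `weightedMean` makes it
possible: the unweighted mean is the Berezin transform, which is unbounded on `L¹`. -/
theorem meanKernel_le {z w : ℂ} (hz : z ∈ disk) (hw : w ∈ disk) :
    meanKernel z w ≤ 16 * jac w z := by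
  have hpos := norm_one_sub_pos hz hw
  have hz1 := one_sub_norm_sq_pos hz
  have hw1 := one_sub_norm_sq_pos hw
  have h1 : 1 - ‖z‖ ^ 2 ≤ 2 * ‖1 - conj z * w‖ := by
    nlinarith [one_sub_norm_le' (z := z) hw, mem_disk.1 hz, norm_nonneg z]
  have h2 : (1 - ‖z‖ ^ 2) ^ 4 ≤ 16 * ‖1 - conj z * w‖ ^ 4 := by
    calc _ ≤ (2 * ‖1 - conj z * w‖) ^ 4 := by gcongr
      _ = _ := by ring
  have h3 : meanKernel z w =
      (1 - ‖z‖ ^ 2) ^ 4 / ‖1 - conj z * w‖ ^ 4 * jac w z := by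
    rw [meanKernel, one_sub_norm_mobius_sq hz hw, jac, jac, norm_one_sub_conj_mul_comm w z]
    field_simp
  rw [h3]
  refine mul_le_mul_of_nonneg_right ?_ (jac_nonneg w z)
  rwa [div_le_iff₀ (by positivity)]

/-- By Tonelli it suffices to integrate the kernel in its first variable. This bound is what allows
the bad points to be absorbed in Luecking's theorem. -/
theorem lintegral_weightedMean_le {h : ℂ → ℝ≥0∞} (hh : Measurable h) :
    ∫⁻ z, weightedMean h z ∂dA ≤ 16 * ∫⁻ w, h w ∂dA := by
  have hm : Measurable fun p : ℂ × ℂ => ENNReal.ofReal (meanKernel p.1 p.2) * h p.2 :=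
    measurable_meanKernel.ennreal_ofReal.mul (hh.comp measurable_snd)
  calc ∫⁻ z, weightedMean h z ∂dA
      = ∫⁻ z, ∫⁻ w, ENNReal.ofReal (meanKernel z w) * h w ∂dA ∂dA := by
        refine lintegral_congr_ae ?_
        filter_upwards [ae_mem_disk] with z hz using weightedMean_eq hz h
    _ = ∫⁻ w, ∫⁻ z, ENNReal.ofReal (meanKernel z w) * h w ∂dA ∂dA :=
        lintegral_lintegral_swap hm.aemeasurable
    _ ≤ ∫⁻ w, 16 * h w ∂dA := by
        refine lintegral_mono_ae ?_
        filter_upwards [ae_mem_disk] with w hw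
        rw [lintegral_mul_const _ (measurable_meanKernel_left w).ennreal_ofReal]
        gcongr
        calc ∫⁻ z, ENNReal.ofReal (meanKernel z w) ∂dA
            ≤ ∫⁻ z, 16 * ENNReal.ofReal (jac w z) ∂dA := by
              refine lintegral_mono_ae ?_
              filter_upwards [ae_mem_disk] with z hz
              refine (ENNReal.ofReal_le_ofReal (meanKernel_le hz hw)).trans (le_of_eq ?_)
              rw [ENNReal.ofReal_mul (by norm_num)]
              norm_num
          _ = 16 := by
              rw [lintegral_const_mul _ (measurable_jac_right w).ennreal_ofReal,
                lintegral_jac hw, mul_one]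
    _ = _ := lintegral_const_mul _ hh

theorem differentiableOn_comp_mobius {f : ℂ → ℂ} (hf : DifferentiableOn ℂ f disk) {z : ℂ}
    (hz : z ∈ disk) : DifferentiableOn ℂ (fun u => f (mobius z u)) disk :=
  hf.comp (fun _ hu => (hasDerivAt_mobius hz hu).differentiableAt.differentiableWithinAt)
    fun _ hu => mobius_mem_disk hz hu

/-- Luecking's theorem: a set that meets all pseudo-hyperbolic disks of a fixed radius in a fixed
proportion dominates the Bergman norm. -/
theorem isReverseCarleson_charMeasure_of_dA_ge {G : Set ℂ} (hG : MeasurableSet G) {r δ : ℝ}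
    (hr0 : 0 < r) (hr : r < 1) (hδ : 0 < δ)
    (h : ∀ z ∈ disk, ENNReal.ofReal δ ≤ dA (Metric.ball 0 r ∩ mobius z ⁻¹' G)) :
    IsReverseCarleson (charMeasure G) := by
  -- Half of the reciprocal of the constant `16` in `lintegral_weightedMean_le`, so that bad points
  -- account for at most half of the integral.
  obtain ⟨c, hc, hloc⟩ := exists_mul_enorm_sq_le hr0 hr hδ (ε := 1 / 32) (by norm_num)
  have hr2 : 0 < 1 - r ^ 2 := by nlinarith
  -- The factor `(1 - r²)²` is a lower bound for the weight of `weightedMean` on the ball of radius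
  -- `r`.
  set d := c * (1 - r ^ 2) ^ 2 with hd
  have hd0 : 0 < d := by positivity
  refine isReverseCarleson_charMeasure.2 ⟨d / 32, by positivity, fun f hf => ?_⟩
  classical
  set F : ℂ → ℝ≥0∞ := fun w => ‖disk.piecewise f 0 w‖ₑ ^ 2 with hF
  have hFm : Measurable F :=
    ((hf.1.continuousOn.measurable_piecewise continuousOn_const measurableSet_disk).enorm).pow_const
      2
  have hFf : ∀ w ∈ disk, F w = ‖f w‖ₑ ^ 2 := fun w hw => by
    rw [hF]
    simp only [Set.piecewise_eq_of_mem _ _ _ hw]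
  have hFae : ∀ᵐ w ∂dA, F w = ‖f w‖ₑ ^ 2 := by
    filter_upwards [ae_mem_disk] with w hw using hFf w hw
  rw [← lintegral_congr_ae hFae, ← lintegral_congr_ae (ae_restrict_of_ae hFae)]
  -- Finiteness of the norm is what permits subtracting the absorbed half in `ℝ≥0∞`.
  have hfin : ∫⁻ w, F w ∂dA ≠ ∞ := by
    rw [lintegral_congr_ae hFae, ← eLpNorm_two_sq]
    exact ENNReal.pow_ne_top hf.2.2.ne
  -- At a good point the second term alone suffices, by the local estimate for `f ∘ mobius z`; at a
  -- bad point the first term does, by definition.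
  have hpt : ∀ z ∈ disk, ENNReal.ofReal d * F z ≤
      ENNReal.ofReal (d / 32) * weightedMean F z + weightedMean (G.indicator F) z := by
    intro z hz
    have hdiff := differentiableOn_comp_mobius hf.1 hz
    have hT : weightedMean F z =
        ∫⁻ u, ENNReal.ofReal ((1 - ‖u‖ ^ 2) ^ 2) * ‖f (mobius z u)‖ₑ ^ 2 ∂dA := by
      refine lintegral_congr_ae ?_
      filter_upwards [ae_mem_disk] with u hu
      rw [hFf _ (mobius_mem_disk hz hu)]
    by_cases hgood : ENNReal.ofReal (1 / 32) * weightedMean F z ≤ ‖f z‖ₑ ^ 2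
    · refine le_trans ?_ le_add_self
      have h1 := hloc _ hdiff (by rw [← hT, mobius_zero]; exact hgood) _
        (measurable_mobius z hG) (h z hz)
      rw [mobius_zero, ← hFf z hz] at h1
      rw [hd, mul_comm c, ENNReal.ofReal_mul (by positivity), mul_assoc]
      have hbm : MeasurableSet (Metric.ball (0 : ℂ) r ∩ mobius z ⁻¹' G) :=
        Metric.isOpen_ball.measurableSet.inter (measurable_mobius z hG)
      calc _ ≤ ENNReal.ofReal ((1 - r ^ 2) ^ 2) *
            ∫⁻ u in Metric.ball 0 r ∩ mobius z ⁻¹' G, ‖f (mobius z u)‖ₑ ^ 2 ∂dA := by gcongr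
        _ = ∫⁻ u in Metric.ball 0 r ∩ mobius z ⁻¹' G,
              ENNReal.ofReal ((1 - r ^ 2) ^ 2) * ‖f (mobius z u)‖ₑ ^ 2 ∂dA := by
            rw [lintegral_const_mul' _ _ ENNReal.ofReal_ne_top]
        _ ≤ ∫⁻ u in Metric.ball 0 r ∩ mobius z ⁻¹' G,
              ENNReal.ofReal ((1 - ‖u‖ ^ 2) ^ 2) * G.indicator F (mobius z u) ∂dA := by
            refine setLIntegral_mono' hbm fun u hu => ?_
            have hur := mem_ball_zero_iff.1 hu.1
            rw [Set.indicator_of_mem (show mobius z u ∈ G from hu.2),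
              hFf _ (mobius_mem_disk hz (Metric.ball_subset_ball hr.le hu.1))]
            gcongr
        _ ≤ _ := setLIntegral_le_lintegral _ _
    · refine le_trans ?_ le_self_add
      rw [← hFf z hz] at hgood
      calc ENNReal.ofReal d * F z ≤ ENNReal.ofReal d * (ENNReal.ofReal (1 / 32) * weightedMean F z) := by
            gcongr
            exact (not_le.1 hgood).le
        _ = _ := by
            rw [← mul_assoc, ← ENNReal.ofReal_mul hd0.le, mul_one_div]
  have h16 : ENNReal.ofReal 16 = 16 := by norm_num
  have hint : ENNReal.ofReal d * ∫⁻ w, F w ∂dA ≤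
      ENNReal.ofReal (d / 2) * ∫⁻ w, F w ∂dA + 16 * ∫⁻ w in G, F w ∂dA := by
    calc ENNReal.ofReal d * ∫⁻ w, F w ∂dA = ∫⁻ w, ENNReal.ofReal d * F w ∂dA :=
          (lintegral_const_mul _ hFm).symm
      _ ≤ ∫⁻ z, (ENNReal.ofReal (d / 32) * weightedMean F z +
            weightedMean (G.indicator F) z) ∂dA := by
          refine lintegral_mono_ae ?_
          filter_upwards [ae_mem_disk] with z hz using hpt z hz
      _ = ENNReal.ofReal (d / 32) * ∫⁻ z, weightedMean F z ∂dA +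
            ∫⁻ z, weightedMean (G.indicator F) z ∂dA := by
          rw [lintegral_add_left ((measurable_weightedMean hFm).const_mul _),
            lintegral_const_mul _ (measurable_weightedMean hFm)]
      _ ≤ ENNReal.ofReal (d / 32) * (16 * ∫⁻ w, F w ∂dA) +
            16 * ∫⁻ w, G.indicator F w ∂dA := by
          gcongr
          · exact lintegral_weightedMean_le hFm
          · exact lintegral_weightedMean_le (hFm.indicator hG)
      _ = _ := by
          rw [lintegral_indicator hG, ← mul_assoc, ← h16, ← ENNReal.ofReal_mul (by positivity)]
          congr 3
          ring
  have hsplit : ENNReal.ofReal d = ENNReal.ofReal (d / 2) + ENNReal.ofReal (d / 2) := by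
    rw [← ENNReal.ofReal_add (by positivity) (by positivity), add_halves]
  rw [hsplit, add_mul] at hint
  have h1 := (ENNReal.add_le_add_iff_left (ENNReal.mul_ne_top ENNReal.ofReal_ne_top hfin)).1 hint
  refine (ENNReal.mul_le_mul_iff_right (a := 16) (by norm_num) (by norm_num)).1
    (le_trans (le_of_eq ?_) h1)
  rw [← mul_assoc, ← h16, ← ENNReal.ofReal_mul (by norm_num)]
  congr 2
  ring

/-! ### The Toeplitz operator and its quadratic form -/

theorem enorm_sq_eq_lintegral (F : Lp ℂ 2 dA) : ‖F‖ₑ ^ 2 = ∫⁻ z, ‖F z‖ₑ ^ 2 ∂dA := by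
  rw [Lp.enorm_def, eLpNorm_two_sq]

theorem ofReal_norm_sq {E : Type*} [SeminormedAddCommGroup E] (x : E) :
    ENNReal.ofReal (‖x‖ ^ 2) = ‖x‖ₑ ^ 2 := by
  rw [ENNReal.ofReal_pow (norm_nonneg _), ofReal_norm]

/-- Multiplication by `φ ∈ L^∞(𝔻, dA)` as an operator on `L^2(𝔻, dA)`. -/
def multiplication (φ : ℂ → ℂ) (hφ : MemLp φ ∞ dA) : Lp ℂ 2 dA →L[ℂ] Lp ℂ 2 dA :=
  (ContinuousLinearMap.mul ℂ ℂ).holderL dA ∞ 2 2 (hφ.toLp φ)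

theorem coeFn_multiplication (φ : ℂ → ℂ) (hφ : MemLp φ ∞ dA) (F : Lp ℂ 2 dA) :
    multiplication φ hφ F =ᵐ[dA] fun z => φ z * F z := by
  have h : multiplication φ hφ F =ᵐ[dA] fun z => (hφ.toLp φ) z * F z :=
    (ContinuousLinearMap.mul ℂ ℂ).coeFn_holder (hφ.toLp φ) F
  filter_upwards [h, hφ.coeFn_toLp] with z h1 h2
  rw [h1, h2]

theorem toeplitz_apply (φ : ℂ → ℂ) (hφ : MemLp φ ∞ dA) (F : bergmanSpace) :
    toeplitz φ hφ F = bergmanSpace.orthogonalProjectionOnto (multiplication φ hφ F) := rfl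

/-- The projection can be dropped from `⟨P(φF), F⟩` because `F` already lies in the Bergman space.
-/
theorem ofReal_norm_inner_toeplitz {φ : ℂ → ℝ} (hφ : MemLp φ ∞ dA) (hpos : ∀ᵐ z ∂dA, 0 ≤ φ z)
    (F : bergmanSpace) :
    ENNReal.ofReal ‖inner ℂ (toeplitz (fun z => (φ z : ℂ)) hφ.ofReal F) F‖ =
      ∫⁻ z, ENNReal.ofReal (φ z) * ‖(F : Lp ℂ 2 dA) z‖ₑ ^ 2 ∂dA := by
  set f : Lp ℂ 2 dA := F.1
  have h1 : inner ℂ (toeplitz (fun z => (φ z : ℂ)) hφ.ofReal F) F =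
      ((∫ z, φ z * ‖f z‖ ^ 2 ∂dA : ℝ) : ℂ) := by
    rw [toeplitz_apply, Submodule.inner_orthogonalProjectionOnto_eq_of_mem_right, L2.inner_def,
      ← integral_complex_ofReal]
    refine integral_congr_ae ?_
    filter_upwards [coeFn_multiplication (fun z => (φ z : ℂ)) hφ.ofReal f] with z hz
    rw [hz]
    simp only [RCLike.inner_apply, map_mul, Complex.conj_ofReal, Complex.ofReal_mul,
      Complex.ofReal_pow]
    rw [mul_left_comm, Complex.mul_conj']
  have hnn : 0 ≤ᵐ[dA] fun z => φ z * ‖f z‖ ^ 2 := by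
    filter_upwards [hpos] with z hz
    exact mul_nonneg hz (by positivity)
  have hi : Integrable (fun z => φ z * ‖f z‖ ^ 2) dA := by
    obtain ⟨M, hM⟩ := exists_ae_norm_le hφ
    exact ((memLp_two_iff_integrable_sq_norm (Lp.memLp f).1).1 (Lp.memLp f)).bdd_mul hφ.1 hM
  rw [h1, Complex.norm_real, Real.norm_of_nonneg (integral_nonneg_of_ae hnn),
    ofReal_integral_eq_lintegral_ofReal hi hnn]
  refine lintegral_congr_ae ?_
  filter_upwards [hpos] with z hz
  rw [ENNReal.ofReal_mul hz, ofReal_norm_sq]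

/-- The projection is a contraction and `φ² ≤ Mφ`. The norm of `T_φ F` is thereby controlled by the
quadratic form. -/
theorem enorm_toeplitz_sq_le {φ : ℂ → ℝ} (hφ : MemLp φ ∞ dA) (hpos : ∀ᵐ z ∂dA, 0 ≤ φ z) {M : ℝ}
    (hM : ∀ᵐ z ∂dA, φ z ≤ M) (F : bergmanSpace) :
    ‖toeplitz (fun z => (φ z : ℂ)) hφ.ofReal F‖ₑ ^ 2 ≤
      ENNReal.ofReal M * ∫⁻ z, ENNReal.ofReal (φ z) * ‖(F : Lp ℂ 2 dA) z‖ₑ ^ 2 ∂dA := by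
  set f : Lp ℂ 2 dA := F.1
  have h1 : ‖toeplitz (fun z => (φ z : ℂ)) hφ.ofReal F‖ ≤
      ‖multiplication (fun z => (φ z : ℂ)) hφ.ofReal f‖ := by
    rw [toeplitz_apply]
    exact Submodule.norm_orthogonalProjectionOnto_apply_le _ _
  rw [← ofReal_norm_sq]
  calc _ ≤ ENNReal.ofReal (‖multiplication (fun z => (φ z : ℂ)) hφ.ofReal f‖ ^ 2) := by gcongr
    _ = ∫⁻ z, ‖multiplication (fun z => (φ z : ℂ)) hφ.ofReal f z‖ₑ ^ 2 ∂dA := by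
        rw [ofReal_norm_sq, enorm_sq_eq_lintegral]
    _ ≤ ∫⁻ z, ENNReal.ofReal M * (ENNReal.ofReal (φ z) * ‖f z‖ₑ ^ 2) ∂dA := by
        refine lintegral_mono_ae ?_
        filter_upwards [coeFn_multiplication (fun z => (φ z : ℂ)) hφ.ofReal f, hpos, hM] with z h1 h2 h3
        rw [h1, enorm_mul, mul_pow, ← mul_assoc]
        gcongr
        rw [← ofReal_norm_sq, ← ENNReal.ofReal_mul (h2.trans h3), Complex.norm_real,
          Real.norm_of_nonneg h2]
        refine ENNReal.ofReal_le_ofReal ?_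
        nlinarith
    _ = _ := lintegral_const_mul' _ _ ENNReal.ofReal_ne_top

/-- A left inverse bounds `T_φ` from below, which `enorm_toeplitz_sq_le` converts into coercivity of
the form. Conversely, a bounded operator with a coercive form is invertible, by Lax–Milgram. -/
theorem isUnit_toeplitz_iff {φ : ℂ → ℝ} (hφ : MemLp φ ∞ dA) (hpos : ∀ᵐ z ∂dA, 0 ≤ φ z) :
    IsUnit (toeplitz (fun z => (φ z : ℂ)) hφ.ofReal) ↔ IsReverseCarleson (measureOf φ) := by
  rw [isReverseCarleson_measureOf hφ.1.aemeasurable]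
  set T := toeplitz (fun z => (φ z : ℂ)) hφ.ofReal
  constructor
  · rintro hT
    obtain ⟨S, hS⟩ := hT.exists_left_inv
    obtain ⟨M, hM⟩ := exists_ae_norm_le hφ
    have hM' : ∀ᵐ z ∂dA, φ z ≤ |M| + 1 := by
      filter_upwards [hM] with z hz
      linarith [le_abs_self (φ z), le_abs_self M, Real.norm_eq_abs (φ z)]
    have hK : ∀ F, ‖F‖ ≤ (‖S‖ + 1) * ‖T F‖ := by
      intro F
      have h1 : S (T F) = F := by
        change (S * T) F = F
        rw [hS]
        rfl
      calc ‖F‖ = ‖S (T F)‖ := by rw [h1]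
        _ ≤ ‖S‖ * ‖T F‖ := S.le_opNorm _
        _ ≤ _ := by gcongr; linarith
    set K := ‖S‖ + 1 with hKdef
    have hK0 : 0 < K := by positivity
    have hM0 : 0 < |M| + 1 := by positivity
    refine ⟨(K ^ 2 * (|M| + 1))⁻¹, by positivity, fun f hf => ?_⟩
    -- The inequality concerns functions and the operator acts on classes; `e1` and `e2` identify
    -- the two sides.
    let F : bergmanSpace := ⟨hf.2.toLp f, f, hf, hf.2.coeFn_toLp⟩
    have hFf : ((F : Lp ℂ 2 dA) : ℂ → ℂ) =ᵐ[dA] f := hf.2.coeFn_toLp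
    have e1 : ∫⁻ z, ‖f z‖ₑ ^ 2 ∂dA = ‖F‖ₑ ^ 2 := by
      change _ = ‖(F : Lp ℂ 2 dA)‖ₑ ^ 2
      rw [enorm_sq_eq_lintegral]
      refine lintegral_congr_ae ?_
      filter_upwards [hFf] with z hz
      rw [hz]
    have e2 : ∫⁻ z, ENNReal.ofReal (φ z) * ‖f z‖ₑ ^ 2 ∂dA =
        ∫⁻ z, ENNReal.ofReal (φ z) * ‖(F : Lp ℂ 2 dA) z‖ₑ ^ 2 ∂dA := by
      refine lintegral_congr_ae ?_
      filter_upwards [hFf] with z hz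
      rw [hz]
    rw [e1, e2]
    set Q := ∫⁻ z, ENNReal.ofReal (φ z) * ‖(F : Lp ℂ 2 dA) z‖ₑ ^ 2 ∂dA
    have h2 : ‖F‖ₑ ^ 2 ≤ ENNReal.ofReal (K ^ 2 * (|M| + 1)) * Q := by
      calc ‖F‖ₑ ^ 2 = ENNReal.ofReal (‖F‖ ^ 2) := (ofReal_norm_sq F).symm
        _ ≤ ENNReal.ofReal ((K * ‖T F‖) ^ 2) := by
            gcongr
            exact hK F
        _ = ENNReal.ofReal (K ^ 2) * ‖T F‖ₑ ^ 2 := by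
            rw [mul_pow, ENNReal.ofReal_mul (by positivity), ofReal_norm_sq]
        _ ≤ ENNReal.ofReal (K ^ 2) * (ENNReal.ofReal (|M| + 1) * Q) := by
            gcongr
            exact enorm_toeplitz_sq_le hφ hpos hM' F
        _ = _ := by rw [← mul_assoc, ← ENNReal.ofReal_mul (by positivity)]
    calc _ ≤ ENNReal.ofReal (K ^ 2 * (|M| + 1))⁻¹ * (ENNReal.ofReal (K ^ 2 * (|M| + 1)) * Q) := by
          gcongr
      _ = Q := by
          rw [← mul_assoc, ← ENNReal.ofReal_mul (by positivity), inv_mul_cancel₀ (by positivity),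
            ENNReal.ofReal_one, one_mul]
  · rintro ⟨C, hC, h⟩
    refine ContinuousLinearMap.isUnit_of_forall_le_norm_inner_map T (c := ⟨C, hC.le⟩) hC
      fun F => ?_
    obtain ⟨f, hf, hFf⟩ := F.2
    have h1 := h f hf
    have e1 : ∫⁻ z, ‖f z‖ₑ ^ 2 ∂dA = ‖F‖ₑ ^ 2 := by
      change _ = ‖(F : Lp ℂ 2 dA)‖ₑ ^ 2
      rw [enorm_sq_eq_lintegral]
      refine lintegral_congr_ae ?_
      filter_upwards [hFf] with z hz
      rw [hz]
    have e2 : ∫⁻ z, ENNReal.ofReal (φ z) * ‖f z‖ₑ ^ 2 ∂dA =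
        ∫⁻ z, ENNReal.ofReal (φ z) * ‖(F : Lp ℂ 2 dA) z‖ₑ ^ 2 ∂dA := by
      refine lintegral_congr_ae ?_
      filter_upwards [hFf] with z hz
      rw [hz]
    rw [e1, e2, ← ofReal_norm_inner_toeplitz hφ hpos, ← ofReal_norm_sq,
      ← ENNReal.ofReal_mul hC.le, ENNReal.ofReal_le_ofReal_iff (norm_nonneg _), mul_comm] at h1
    exact h1

/-! ### Choice of a representative of the symbol -/

theorem measureOf_congr {φ ψ : ℂ → ℝ} (h : φ =ᵐ[dA] ψ) : measureOf φ = measureOf ψ := by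
  refine withDensity_congr_ae ?_
  filter_upwards [h] with z hz
  rw [hz]

theorem charMeasure_superlevel_congr {φ ψ : ℂ → ℝ} (h : φ =ᵐ[dA] ψ) (r : ℝ) :
    charMeasure {z | z ∈ disk ∧ r < φ z} = charMeasure {z | z ∈ disk ∧ r < ψ z} := by
  refine Measure.restrict_congr_set ?_
  filter_upwards [h] with z hz
  change (z ∈ disk ∧ r < φ z) = (z ∈ disk ∧ r < ψ z)
  rw [hz]

/-- Truncating a measurable representative to `[0, |M| + 1]` changes it only on a null set and makes
all bounds hold at every point. -/
theorem exists_measurable_bounded_ae_eq {φ : ℂ → ℝ} (hφ : MemLp φ ∞ dA)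
    (hpos : ∀ᵐ z ∂dA, 0 ≤ φ z) :
    ∃ ψ : ℂ → ℝ, Measurable ψ ∧ (∀ z, 0 ≤ ψ z) ∧ (∃ M, 0 < M ∧ ∀ z, ψ z ≤ M) ∧ φ =ᵐ[dA] ψ := by
  obtain ⟨M, hM⟩ := exists_ae_norm_le hφ
  have hm := hφ.1.aemeasurable
  refine ⟨fun z => max 0 (min (hm.mk φ z) (|M| + 1)),
    measurable_const.max (hm.measurable_mk.min measurable_const), fun z => le_max_left _ _,
    ⟨|M| + 1, by positivity, fun z => max_le (by positivity) (min_le_right _ _)⟩, ?_⟩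
  filter_upwards [hM, hpos, hm.ae_eq_mk] with z h1 h2 h3
  rw [← h3, min_eq_left, max_eq_right h2]
  linarith [le_abs_self (φ z), le_abs_self M, Real.norm_eq_abs (φ z)]

end Bergman
end

/-! ### The equivalences -/

theorem theoremM1 (φ : ℂ → ℝ) (hφ : MemLp φ ∞ Bergman.dA)
    (hpos : ∀ᵐ z ∂Bergman.dA, 0 ≤ φ z) :
    List.TFAE [
      IsUnit (Bergman.toeplitz (fun z => (φ z : ℂ)) hφ.ofReal),
      Bergman.IsInvertibleLinfty (Bergman.berezin (Bergman.measureOf φ)),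
      Bergman.IsBoundedBelowOnDisk (Bergman.berezin (Bergman.measureOf φ)),
      ∃ r : ℝ, 0 < r ∧
        Bergman.IsReverseCarleson (Bergman.charMeasure {z | z ∈ Bergman.disk ∧ r < φ z}),
      Bergman.IsReverseCarleson (Bergman.measureOf φ),
      Bergman.ReverseCarlesonCondition (Bergman.measureOf φ)] := by
  -- Invertibility is replaced first, since the operator carries the proof `hφ` about `φ`; every
  -- remaining condition depends only on the measures, so `φ` may be exchanged for `ψ`.
  rw [Bergman.isUnit_toeplitz_iff hφ hpos]
  obtain ⟨ψ, hψ, hψ0, ⟨M, hM0, hM⟩, hae⟩ := Bergman.exists_measurable_bounded_ae_eq hφ hpos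
  simp only [Bergman.measureOf_congr hae, Bergman.charMeasure_superlevel_congr hae]
  tfae_have 1 ↔ 5 := Iff.rfl
  tfae_have 2 ↔ 3 := Bergman.isInvertibleLinfty_iff_isBoundedBelowOnDisk
    (Bergman.continuousOn_berezin hψ hψ0 hM) (M := M) fun z hz => by
      rw [abs_of_nonneg (Bergman.berezin_nonneg _ z)]
      exact Bergman.berezin_le hψ hψ0 hM hz
  tfae_have 5 → 3 := fun h => h.isBoundedBelowOnDisk hψ hM
  tfae_have 3 → 6 := fun h => h.reverseCarlesonCondition hψ hM0 hM
  tfae_have 6 → 4 := fun h => by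
    obtain ⟨t, ht, r, hr0, hr, δ, hδ, hG⟩ := h.exists_dA_ge hψ hM0 hM
    exact ⟨t, ht, Bergman.isReverseCarleson_charMeasure_of_dA_ge
      (Bergman.measurableSet_disk.inter (measurableSet_lt measurable_const hψ)) hr0 hr hδ hG⟩
  tfae_have 4 → 5 := fun ⟨r, hr, h⟩ => h.of_charMeasure hψ hr
  tfae_finish
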